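/- Let $p$ be a prime, let $G=\mathbb F_p^n$ and $H=\mathbb F_p^m$, and let $\mathcal A$ be the group algebra of $H$, that is, the functions $f:H\to\mathbb R$ with convolution as product, adjoint $f^*(a)=f(-a)$, inner product $\langle f,g\rangle=\sum_a f(a)g(a)$ and $\|f\|_2^2=\langle f,f\rangle$. Let $\Sigma(\mathcal A)$ be the set of non-negative $f$ with $\sum_a f(a)=1$, write $\delta_a$ for the indicator of $a\in H$, and put $d(f,g)=\bigl(\sum_a f(a)\bigr)\bigl(\sum_a g(a)\bigr)-\langle f,g\rangle$. A map $\beta:G^2\to\mathbb F_p^k$ is bi-affine if $\beta(x,y)=\beta_0(x,y)+Ax+By+c$ with $\beta_0$ bilinear, $A,B$ linear and $c$ constant (similarly for maps to $H$). Its rank is the smallest rank of a bilinear form $u\cdot\beta_0$ with $0\neq u\in\mathbb F_p^k$ (infinite if $k=0$). A bilinear Bohr set of codimension $k$ is a level set $B=\{(x,y)\in G^2:\beta(x,y)=z\}$ of a bi-affine map $\beta:G^2\to\mathbb F_p^k$. The rank of $B$ is the largest rank of a bi-affine map (to any $\mathbb F_p^{k'}$) of which $B$ is a level set, and is infinite if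 $B=\emptyset$. A vertical parallelogram of width $w$ and height $h$ is a sequence $P=((x,y),(x,y+h),(x+w,y'),(x+w,y'+h))$; write $\mathcal P(w,h)$ for the set of these. For $\phi:G^2\to\mathcal A$ let $\phi(P)=\phi(x,y)\phi(x,y+h)^*\phi(x+w,y')^*\phi(x+w,y'+h)$, for $\phi:G^2\to H$ let $\phi(P)=\phi(x,y)-\phi(x,y+h)-\phi(x+w,y')+\phi(x+w,y'+h)$, and for $\mu:G^2\to[0,\infty)$ let $\mu(P)$ be the product of the values of $\mu$ at the four vertices. A function $\phi:G^2\to\Sigma(\mathcal A)$ is a $(1-\eta)$-bihomomorphism with respect to $\mu$ if $$\mathbb E_{w,h}\bigl\|\mathbb E_{P\in\mathcal P(w,h)}\mu(P)\phi(P)\bigr\|_2^2\ \ge\ (1-\eta)\,\mathbb E_{w,h}\bigl|\mathbb E_{P\in\mathcal P(w,h)}\mu(P)\bigr|^2 .$$ A 4-arrangement in $B$ is a pair $(P_1,P_2)$ of vertical parallelograms of the same width and height with all their vertices in $B$; $\phi:G^2\to H$ respects it if $\phi(P_1)=\phi(P_2)$. **Theorem.** Let $\eta>0$, let $B\subset G^2$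 be a bilinear Bohr set of codimension $k$ and of rank at least $t$, where $t\ge 60k+9\log_p(\eta^{-1})$. (i) Let $\phi:G^2\to\Sigma(\mathcal A)$ be a $(1-\eta)$-bihomomorphism with respect to the characteristic function of $B$. Then there are a bi-affine map $\gamma:G^2\to H$ and a function $\theta:G\to H$ such that $$\mathbb E_{(x,y)\in B}\,d\bigl(\phi(x,y),\delta_{\gamma(x,y)+\theta(x)}\bigr)\le 27000\,\eta$$ (the average over $B$ being read as $0$ if $B=\emptyset$). (ii) Let $\phi:G^2\to H$ respect at least a proportion $1-\eta$ of the 4-arrangements in $B$. Then there are a bi-affine map $\gamma:G^2\to H$ and a function $\theta:G\to H$ such that $\phi(x,y)=\gamma(x,y)+\theta(x)$ for at least $(1-27000\eta)|B|$ of the pairs $(x,y)\in B$. -/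

import Mathlib

open scoped BigOperators

noncomputable section

namespace NearBihom

/-! ### The group algebra of a finite Abelian group `H`

Only non-negative functions on `H` occur, so real coefficients suffice. The product of the group
algebra is convolution. -/

section GroupAlgebra

variable {H : Type*} [AddCommGroup H] [Fintype H]

/-- The adjoint `f^*(a) = f(-a)` (coefficients are real, so no conjugation is needed). -/
def adj (f : AddMonoidAlgebra ℝ H) : AddMonoidAlgebra ℝ H :=
  AddMonoidAlgebra.ofCoeff (Finsupp.equivMapDomain (Equiv.neg H) f.coeff)

/-- The inner product `⟨f, g⟩ = ∑ a, f(a) g(a)` (defined with sums). -/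
def ip (f g : AddMonoidAlgebra ℝ H) : ℝ := ∑ a, f.coeff a * g.coeff a

/-- The distance `d(f, g) = (∑ a, f(a)) (∑ a, g(a)) - ⟨f, g⟩`; it is `1 - ⟨f, g⟩` for probability
distributions `f` and `g`. -/
def dist (f g : AddMonoidAlgebra ℝ H) : ℝ :=
  (∑ a, f.coeff a) * (∑ a, g.coeff a) - ip f g

variable (H) in
/-- The simplex `Σ(𝒜)`: the non-negative functions on `H` with sum `1`. -/
def simplex : Set (AddMonoidAlgebra ℝ H) :=
  {f | (∀ a, 0 ≤ f.coeff a) ∧ ∑ a, f.coeff a = 1}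

/-- The element `δ_a` of the group algebra. -/
def delta (a : H) : AddMonoidAlgebra ℝ H := AddMonoidAlgebra.single a 1

end GroupAlgebra

/-! ### Vertical parallelograms and 4-arrangements

The vertical parallelograms of width `w` and height `h`, with vertices
`(x, y), (x, y + h), (x + w, y'), (x + w, y' + h)`, are indexed by the triples `P = (x, y, y')`. -/

section Parallelograms

variable {G : Type*} [AddCommGroup G]

/-- `μ(P)`, the product of the values of `μ` at the vertices of `P`. -/
def weight (μ : G → G → ℝ) (w h : G) : G × G × G → ℝ := fun (x, y, y') =>
  μ x y * μ x (y + h) * μ (x + w) y' * μ (x + w) (y' + h)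

/-- `φ(P) = φ(x,y) φ(x,y+h)^* φ(x+w,y')^* φ(x+w,y'+h)` for `φ` with values in the group algebra. -/
def algValue {H : Type*} [AddCommGroup H]
    (φ : G → G → AddMonoidAlgebra ℝ H) (w h : G) :
    G × G × G → AddMonoidAlgebra ℝ H := fun (x, y, y') =>
  φ x y * adj (φ x (y + h)) * adj (φ (x + w) y') * φ (x + w) (y' + h)

/-- `φ` is a `(1 - η)`-bihomomorphism with respect to `μ`:
`𝔼_{w,h} ‖𝔼_P μ(P) φ(P)‖₂² ≥ (1 - η) 𝔼_{w,h} |𝔼_P μ(P)|²`, with `P` ranging over the vertical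
parallelograms of width `w` and height `h`. -/
def IsNearBihom [Fintype G] {H : Type*} [AddCommGroup H] [Fintype H] (η : ℝ)
    (μ : G → G → ℝ) (φ : G → G → AddMonoidAlgebra ℝ H) : Prop :=
  (1 - η) * (𝔼 d : G × G, |𝔼 P : G × G × G, weight μ d.1 d.2 P| ^ 2) ≤
    𝔼 d : G × G,
      ip (𝔼 P : G × G × G, weight μ d.1 d.2 P • algValue φ d.1 d.2 P)
        (𝔼 P : G × G × G, weight μ d.1 d.2 P • algValue φ d.1 d.2 P)

/-- The characteristic function of `B ⊆ G²`. -/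
def charFun [DecidableEq G] (B : Finset (G × G)) (x y : G) : ℝ := if (x, y) ∈ B then 1 else 0

/-- All four vertices of `P` belong to `B`. -/
def InSet (B : Finset (G × G)) (w h : G) : G × G × G → Prop := fun (x, y, y') =>
  (x, y) ∈ B ∧ (x, y + h) ∈ B ∧ (x + w, y') ∈ B ∧ (x + w, y' + h) ∈ B

/-- `φ(P) = φ(x,y) - φ(x,y+h) - φ(x+w,y') + φ(x+w,y'+h)` for `φ` with values in a group. -/
def groupValue {H : Type*} [AddCommGroup H] (φ : G → G → H) (w h : G) :
    G × G × G → H := fun (x, y, y') =>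
  φ x y - φ x (y + h) - φ (x + w) y' + φ (x + w) (y' + h)

/-- The 4-arrangements in `B`: pairs `(P₁, P₂)` of vertical parallelograms in `B` with the same
width `w` and height `h`, recorded as `((w, h), P₁, P₂)`. -/
def arrangements (B : Finset (G × G)) : Set ((G × G) × (G × G × G) × (G × G × G)) :=
  {S | InSet B S.1.1 S.1.2 S.2.1 ∧ InSet B S.1.1 S.1.2 S.2.2}

/-- The 4-arrangements `(P₁, P₂)` in `B` that `φ` respects, that is, with `φ(P₁) = φ(P₂)`. -/
def respectedArrangements {H : Type*} [AddCommGroup H] (B : Finset (G × G)) (φ : G → G → H) :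
    Set ((G × G) × (G × G × G) × (G × G × G)) :=
  {S | S ∈ arrangements B ∧ groupValue φ S.1.1 S.1.2 S.2.1 = groupValue φ S.1.1 S.1.2 S.2.2}

end Parallelograms

/-! ### Bi-affine maps, rank, and bilinear Bohr sets -/

/-- A bi-affine map `X × Y → Z`, `β(x, y) = γ(x, y) + A x + B y + z`, with `γ` bilinear (the
bilinear part), `A` and `B` linear. -/
structure Biaffine (F X Y Z : Type*) [Field F] [AddCommGroup X] [Module F X] [AddCommGroup Y]
    [Module F Y] [AddCommGroup Z] [Module F Z] where
  bilin : X →ₗ[F] Y →ₗ[F] Z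
  left : X →ₗ[F] Z
  right : Y →ₗ[F] Z
  const : Z

section Rank

variable {F X Y Z : Type*} [Field F] [AddCommGroup X] [Module F X] [AddCommGroup Y]
    [Module F Y] [AddCommGroup Z] [Module F Z]

/-- The value of a bi-affine map. -/
def Biaffine.eval (β : Biaffine F X Y Z) (x : X) (y : Y) : Z :=
  β.bilin x y + β.left x + β.right y + β.const

/-- The rank of a bilinear form: the rank of the associated linear map from `X` to the dual
of `Y`. -/
def formRank (f : X →ₗ[F] Y →ₗ[F] F) : ℕ := Module.finrank F (LinearMap.range f)

/-- The rank of a bi-affine map `β` to `F^k`: the smallest rank of a form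
`(x, y) ↦ ∑ i, u i * γ(x, y) i` with `u ≠ 0`, where `γ` is the bilinear part of `β`
(infinite if `k = 0`). -/
def Biaffine.rank {k : ℕ} (β : Biaffine F X Y (Fin k → F)) : ℕ∞ :=
  ⨅ u : {u : Fin k → F // u ≠ 0},
    (formRank (β.bilin.compr₂ (∑ i, u.1 i • (LinearMap.proj i : (Fin k → F) →ₗ[F] F))) : ℕ∞)

/-- `B` is the level set `{(x, y) : β(x, y) = z}`. -/
def IsLevelSet {k : ℕ} (B : Finset (X × Y)) (β : Biaffine F X Y (Fin k → F)) (z : Fin k → F) :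
    Prop :=
  ∀ x y, (x, y) ∈ B ↔ β.eval x y = z

variable (F) in
/-- `B` is a bilinear Bohr set of codimension `k`: a level set of a bi-affine map to `F^k`. -/
def IsBohrSet (k : ℕ) (B : Finset (X × Y)) : Prop :=
  ∃ (β : Biaffine F X Y (Fin k → F)) (z : Fin k → F), IsLevelSet B β z

variable (F) in
open scoped Classical in
/-- The rank of a bilinear Bohr set: the highest possible rank of a bi-affine map of which it is a
level set; the rank of the empty set is infinite by convention. -/
def bohrRank (B : Finset (X × Y)) : ℕ∞ :=
  if B = ∅ then ⊤
  else sSup {r | ∃ (k : ℕ) (β : Biaffine F X Y (Fin k → F)) (z : Fin k → F),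
    IsLevelSet B β z ∧ r = β.rank}

end Rank

end NearBihom

end

open scoped BigOperators

noncomputable section

namespace NearBihom

set_option linter.unusedSectionVars false

/-! ### Near-homomorphisms with values in the probability distributions on a group -/

/-! The column of `B` over `x` is a coset of the kernel of `colMap β bR x = β x + bR`, a linear map
that depends affinely on `x`. High rank makes these maps jointly surjective for most triples and
quintuples of columns. With N = |G| and K = |M|, a typical column has N/K points. A vertical edge of
height h over `x` exists only if h lies in the kernel over `x`, and the fourth column of an
arrangement imposes no further condition on h. So there are about N^8/K^7 arrangements. Both
hypotheses say that the cost `1 - ⟨φ(P),φ(Q)⟩`, summed over arrangements, is at most η times their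
number; part (ii) is the case of point masses.

Single columns. Fix an arrangement except for one vertical edge, and let that edge slide along its
column. A small cost forces the increments of φ along edges of the same height to concentrate on one
value. A 99% homomorphism argument (`exists_affine_of_concentrated_differences`) then gives, on most
columns, an affine map `r x + c x` near which φ is concentrated (`exists_column_maps`).

Quadruples of columns. If the alternating sum of four maps `r` is non-zero somewhere on the common
kernel, it is non-zero on at least half of that kernel, and each such height is expensive. So for
most additive quadruples the sum vanishes on the common kernel (`sum_badQuad_le`).

Removing the ambiguity. Only the restriction of `r x` to the kernel over `x` matters, so `r x` may
be changed by `s x ∘ₗ colMap β bR x`. A good quadruple satisfies its additive relation up to such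
terms. A six-term relation among columns splits into two quadruples in four ways; independence of
the columns forces the four error terms to agree, and this makes each correction depend on one
column only (`exists_adjustment`). The corrected maps satisfy an exact additive relation for most
triples, hence mostly form an affine family `L x + R` (`exists_affine_family`). On the column over
`x` the correction equals the constant `s x (a x)`, which is absorbed in θ.

Finally, the map witnessing the rank of `B` may have another codimension than k;
`codim_le_of_isLevelSet` shows that it is no larger. -/

lemma sum_add_right {V : Type*} [AddCommGroup V] [Fintype V] (g : V → ℝ) (v : V) :
    ∑ a, g (a + v) = ∑ a, g a := Equiv.sum_comp (Equiv.addRight v) g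

lemma sum_add_left {V : Type*} [AddCommGroup V] [Fintype V] (g : V → ℝ) (v : V) :
    ∑ a, g (v + a) = ∑ a, g a := Equiv.sum_comp (Equiv.addLeft v) g

section Distributions

variable {H : Type*} [AddCommGroup H] [Fintype H]

/-- `f` is a probability distribution on `H`. -/
def IsProb (f : H → ℝ) : Prop := (∀ a, 0 ≤ f a) ∧ ∑ a, f a = 1

/-- The probability that independent samples `a` of `f` and `b` of `g` satisfy `b = a + v`. -/
def agr (f g : H → ℝ) (v : H) : ℝ := ∑ a, f a * g (a + v)

lemma IsProb.le_one {f : H → ℝ} (hf : IsProb f) (a : H) : f a ≤ 1 :=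
  hf.2 ▸ Finset.single_le_sum (fun b _ => hf.1 b) (Finset.mem_univ a)

lemma agr_nonneg {f g : H → ℝ} (hf : IsProb f) (hg : IsProb g) (v : H) : 0 ≤ agr f g v :=
  Finset.sum_nonneg fun a _ => mul_nonneg (hf.1 a) (hg.1 _)

lemma sum_agr {f g : H → ℝ} (hf : IsProb f) (hg : IsProb g) : ∑ v, agr f g v = 1 := by
  unfold agr
  rw [Finset.sum_comm]
  have : ∀ a, ∑ v, f a * g (a + v) = f a := fun a => by
    rw [← Finset.mul_sum, sum_add_left g a, hg.2, mul_one]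
  simp only [this, hf.2]

lemma agr_isProb {f g : H → ℝ} (hf : IsProb f) (hg : IsProb g) : IsProb (agr f g) :=
  ⟨agr_nonneg hf hg, sum_agr hf hg⟩

lemma agr_le_one {f g : H → ℝ} (hf : IsProb f) (hg : IsProb g) (v : H) : agr f g v ≤ 1 :=
  (agr_isProb hf hg).le_one v

lemma agr_symm (f g : H → ℝ) (v : H) : agr g f (-v) = agr f g v := by
  unfold agr
  rw [← Equiv.sum_comp (Equiv.addRight v) (fun a => g a * f (a + -v))]
  simp [mul_comm]

/-- A union bound, made pointwise by summing over the middle sample b: for u, g, h in [0,1],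
g(1-u)(1-h) ≥ 0 gives gu + gh - g ≤ guh ≤ uh. -/
lemma agr_triangle {f g h : H → ℝ} (hf : IsProb f) (hg : IsProb g) (hh : IsProb h) (v w : H) :
    agr f g v + agr g h w - 1 ≤ agr f h (v + w) := by
  have e1 : agr f g v = ∑ b, g b * f (b - v) := by
    unfold agr
    rw [← Equiv.sum_comp (Equiv.addRight v) (fun b => g b * f (b - v))]
    simp [mul_comm]
  have e2 : agr f h (v + w) = ∑ b, f (b - v) * h (b + w) := by
    unfold agr
    rw [← Equiv.sum_comp (Equiv.addRight v) (fun b => f (b - v) * h (b + w))]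
    simp [add_assoc]
  rw [e1, e2]
  conv_lhs => rw [← hg.2]
  unfold agr
  rw [← Finset.sum_add_distrib, ← Finset.sum_sub_distrib]
  refine Finset.sum_le_sum fun b _ => ?_
  have h1 := hf.le_one (b - v)
  have h2 := hh.le_one (b + w)
  have h3 := hg.le_one b
  have h4 := hg.1 b
  have h5 := mul_nonneg (hf.1 (b - v)) (hh.1 (b + w))
  nlinarith [mul_nonneg h4 (mul_nonneg (sub_nonneg.2 h1) (sub_nonneg.2 h2)),
    mul_nonneg h5 (sub_nonneg.2 h3)]

lemma agr_add_agr_le {f g : H → ℝ} (hf : IsProb f) (hg : IsProb g) {v w : H} (hvw : v ≠ w) :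
    agr f g v + agr f g w ≤ 1 := by
  classical
  have := agr_isProb hf hg
  rw [← this.2, ← Finset.sum_pair hvw]
  exact Finset.sum_le_univ_sum_of_nonneg this.1

lemma exists_le_of_sum_le_card_mul {ι : Type*} [Fintype ι] [Nonempty ι] {f : ι → ℝ} {c : ℝ}
    (h : ∑ i, f i ≤ Fintype.card ι * c) : ∃ i, f i ≤ c := by
  obtain ⟨i, -, hi⟩ := Finset.exists_le_of_sum_le (s := Finset.univ) (f := f) (g := fun _ => c)
    Finset.univ_nonempty (by simpa using h)
  exact ⟨i, hi⟩

/-- If the differences of a distribution-valued function on `V` are mostly concentrated, then the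
function is mostly concentrated on an affine map. -/
theorem exists_affine_of_concentrated_differences {V : Type*} [AddCommGroup V] [Fintype V]
    {f : V → H → ℝ} (hf : ∀ y, IsProb (f y)) (ρ : V → H) {ε : ℝ} (hε : ε ≤ 1 / 8)
    (h : ∑ d, ∑ y, (1 - agr (f y) (f (y + d)) (ρ d)) ≤ ε * (Fintype.card V) ^ 2) :
    ∃ (r : V →+ H) (c : H), ∑ y, (1 - f y (r y + c)) ≤ 2 * ε * Fintype.card V := by
  classical
  set N : ℝ := (Fintype.card V : ℝ) with hN
  have hN0 : 0 < N := by rw [hN]; exact_mod_cast Fintype.card_pos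
  -- The increment from y + g to y + g + d is compared through y, which gives the value -ρ(g) +
  -- ρ(g+d). Averaging over g shows that some g works for most y.
  have key : ∀ d, ∃ v, ∑ y, (1 - agr (f y) (f (y + d)) v) ≤ 2 * ε * N := by
    intro d
    suffices ∃ g, ∑ y, (1 - agr (f y) (f (y + d)) (-ρ g + ρ (g + d))) ≤ 2 * ε * N from
      ⟨_, this.choose_spec⟩
    apply exists_le_of_sum_le_card_mul
    rw [← hN]
    have h1 : ∑ g, ∑ y, (1 - agr (f y) (f (y + d)) (-ρ g + ρ (g + d))) ≤
        ∑ g, ∑ y, ((1 - agr (f y) (f (y + g)) (ρ g)) +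
          (1 - agr (f y) (f (y + (g + d))) (ρ (g + d)))) := by
      refine Finset.sum_le_sum fun g _ => ?_
      rw [← Equiv.sum_comp (Equiv.addRight g)]
      refine Finset.sum_le_sum fun y _ => ?_
      have h2 := agr_triangle (hf (y + g)) (hf y) (hf (y + (g + d))) (-ρ g) (ρ (g + d))
      rw [agr_symm] at h2
      simp only [Equiv.coe_addRight, add_assoc]
      linarith
    refine h1.trans ?_
    simp only [Finset.sum_add_distrib]
    rw [sum_add_right (fun g => ∑ y, (1 - agr (f y) (f (y + g)) (ρ g))) d]
    nlinarith
  choose r hr using key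
  -- Two different values for the increment d + e would have defects at most 4εN and 2εN, while
  -- their agreements sum to at most 1 at each y. This needs N ≤ 6εN, impossible for ε ≤ 1/8.
  have radd : ∀ d e, r (d + e) = r d + r e := by
    intro d e
    by_contra hne
    have h1 : ∑ y, (1 - agr (f y) (f (y + (d + e))) (r d + r e)) ≤ 4 * ε * N := by
      have h2 : ∑ y, (1 - agr (f y) (f (y + (d + e))) (r d + r e)) ≤
          ∑ y, ((1 - agr (f y) (f (y + d)) (r d)) +
            (1 - agr (f (y + d)) (f (y + d + e)) (r e))) := by
        refine Finset.sum_le_sum fun y _ => ?_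
        have h2 := agr_triangle (hf y) (hf (y + d)) (hf (y + (d + e))) (r d) (r e)
        rw [← add_assoc] at h2 ⊢
        linarith
      refine h2.trans ?_
      rw [Finset.sum_add_distrib,
        sum_add_right (fun y => 1 - agr (f y) (f (y + e)) (r e)) d]
      linarith [hr d, hr e]
    have h3 : ∑ y : V, (1 : ℝ) ≤ ∑ y, ((1 - agr (f y) (f (y + (d + e))) (r d + r e)) +
        (1 - agr (f y) (f (y + (d + e))) (r (d + e)))) := by
      refine Finset.sum_le_sum fun y _ => ?_
      linarith [agr_add_agr_le (hf y) (hf (y + (d + e))) hne]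
    rw [Finset.sum_add_distrib] at h3
    have h4 := hr (d + e)
    simp only [Finset.sum_const, Finset.card_univ, nsmul_eq_mul, mul_one, ← hN] at h3
    nlinarith
  -- Fix a base point from which most increments are right, then a value `a` at least as good as the
  -- average over `f y₀`; together they determine the affine map.
  obtain ⟨y₀, hy₀⟩ : ∃ y, ∑ d, (1 - agr (f y) (f (y + d)) (r d)) ≤ 2 * ε * N := by
    apply exists_le_of_sum_le_card_mul
    rw [Finset.sum_comm, ← hN]
    calc _ ≤ ∑ d : V, 2 * ε * N := Finset.sum_le_sum fun d _ => hr d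
      _ = _ := by simp [hN]
  obtain ⟨a, ha⟩ : ∃ a, ∑ d, (1 - f (y₀ + d) (a + r d)) ≤ 2 * ε * N := by
    by_contra! hcon
    have h5 : ∑ a, f y₀ a * (2 * ε * N) < ∑ a, f y₀ a * ∑ d, (1 - f (y₀ + d) (a + r d)) := by
      apply Finset.sum_lt_sum
      · exact fun a _ => mul_le_mul_of_nonneg_left (hcon a).le ((hf y₀).1 a)
      · obtain ⟨a, -, ha⟩ : ∃ a ∈ Finset.univ, 0 < f y₀ a := by
          by_contra! h0
          linarith [(hf y₀).2, Finset.sum_nonpos h0]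
        exact ⟨a, Finset.mem_univ _, mul_lt_mul_of_pos_left (hcon a) ha⟩
    rw [← Finset.sum_mul, (hf y₀).2, one_mul] at h5
    refine absurd hy₀ (not_le.2 (h5.trans_le (le_of_eq ?_)))
    simp only [Finset.mul_sum]
    rw [Finset.sum_comm]
    refine Finset.sum_congr rfl fun d _ => ?_
    simp only [mul_sub, mul_one, Finset.sum_sub_distrib, (hf y₀).2, agr]
  refine ⟨AddMonoidHom.mk' r radd, a - r y₀, ?_⟩
  rw [← Equiv.sum_comp (Equiv.addLeft y₀)]
  refine (Finset.sum_le_sum fun d _ => ?_).trans ha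
  simp only [Equiv.coe_addLeft, AddMonoidHom.mk'_apply, radd]
  rw [show r y₀ + r d + (a - r y₀) = a + r d by abel]

end Distributions

/-! ### Probability distributions under convolution -/

section Convolution

variable {H : Type*} [AddCommGroup H] [Fintype H]

lemma mem_simplex_iff {f : AddMonoidAlgebra ℝ H} : f ∈ simplex H ↔ IsProb f.coeff := Iff.rfl

lemma coeff_mul_eq_sum (f g : AddMonoidAlgebra ℝ H) (c : H) :
    (f * g).coeff c = ∑ a, f.coeff a * g.coeff (c - a) := by
  classical
  rw [AddMonoidAlgebra.coeff_mul_antidiag f g c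
    (Finset.univ.map ⟨fun a => (a, c - a), fun a b h => (Prod.ext_iff.1 h).1⟩)]
  · rw [Finset.sum_map]
    rfl
  · rintro ⟨a, b⟩
    rw [Finset.mem_map]
    constructor
    · rintro ⟨d, -, hd⟩
      obtain ⟨rfl, rfl⟩ := Prod.ext_iff.1 hd
      exact add_sub_cancel _ _
    · rintro rfl
      exact ⟨a, Finset.mem_univ _, Prod.ext rfl (add_sub_cancel_left _ _)⟩

@[simp] lemma coeff_adj (f : AddMonoidAlgebra ℝ H) (a : H) : (adj f).coeff a = f.coeff (-a) := by
  simp [adj]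

lemma adj_mem_simplex {f : AddMonoidAlgebra ℝ H} (hf : f ∈ simplex H) : adj f ∈ simplex H := by
  refine ⟨fun a => by simpa using hf.1 (-a), ?_⟩
  simp only [coeff_adj]
  exact (Equiv.sum_comp (Equiv.neg H) f.coeff).trans hf.2

lemma mul_mem_simplex {f g : AddMonoidAlgebra ℝ H} (hf : f ∈ simplex H) (hg : g ∈ simplex H) :
    f * g ∈ simplex H := by
  refine ⟨fun a => ?_, ?_⟩
  · rw [coeff_mul_eq_sum]
    exact Finset.sum_nonneg fun b _ => mul_nonneg (hf.1 _) (hg.1 _)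
  · simp only [coeff_mul_eq_sum]
    rw [Finset.sum_comm]
    have : ∀ a, ∑ c, f.coeff a * g.coeff (c - a) = f.coeff a := fun a => by
      rw [← Finset.mul_sum]
      simp only [sub_eq_add_neg]
      rw [sum_add_right (fun c => g.coeff c), hg.2, mul_one]
    simp only [this, hf.2]

lemma delta_mem_simplex (a : H) : delta a ∈ simplex H := by
  classical
  refine ⟨fun b => ?_, ?_⟩
  · simp only [delta, AddMonoidAlgebra.coeff_single, Finsupp.single_apply]
    split_ifs <;> simp
  · simp [delta, Finsupp.single_apply]

lemma ip_le_one {f g : AddMonoidAlgebra ℝ H} (hf : f ∈ simplex H) (hg : g ∈ simplex H) :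
    ip f g ≤ 1 := by
  rw [← hf.2]
  exact Finset.sum_le_sum fun a _ =>
    mul_le_of_le_one_right (hf.1 a) (IsProb.le_one (mem_simplex_iff.1 hg) a)

lemma dist_delta {f : AddMonoidAlgebra ℝ H} (hf : f ∈ simplex H) (a : H) :
    dist f (delta a) = 1 - f.coeff a := by
  classical
  rw [dist, hf.2, (delta_mem_simplex a).2]
  simp [ip, delta, Finsupp.single_apply]

lemma ip_delta_delta [DecidableEq H] (a b : H) :
    ip (delta a) (delta b) = if a = b then 1 else 0 := by
  simp [ip, delta, Finsupp.single_apply]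

/-- If the differences of the pairs `(f₁ y, f₂ y)` agree with no single value too often, then the
inner products of the products `f₁ y (f₂ y)^* m` with a fixed distribution are small on average. -/
lemma sum_ip_mul_le {ι : Type*} (s : Finset ι) (f₁ f₂ : ι → AddMonoidAlgebra ℝ H)
    {m₁ m₂ g : AddMonoidAlgebra ℝ H} (hm₁ : m₁ ∈ simplex H) (hm₂ : m₂ ∈ simplex H)
    (hg : g ∈ simplex H) {A : ℝ}
    (hA : ∀ v, ∑ y ∈ s, agr (f₁ y).coeff (f₂ y).coeff v ≤ A) :
    ∑ y ∈ s, ip (f₁ y * adj (f₂ y) * m₁ * m₂) g ≤ A := by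
  have hm := mul_mem_simplex hm₁ hm₂
  set m := m₁ * m₂ with hmdef
  -- The mass of f₁ f₂^* at a is the agreement of f₁ and f₂ at -a. The sum over y can therefore be
  -- taken inside, against weights over a that sum to 1.
  have e : ∀ y, ip (f₁ y * adj (f₂ y) * m₁ * m₂) g =
      ∑ a, agr (f₁ y).coeff (f₂ y).coeff (-a) * ∑ c, m.coeff (c - a) * g.coeff c := by
    intro y
    rw [mul_assoc (f₁ y * adj (f₂ y)), ← hmdef, ip]
    simp only [coeff_mul_eq_sum (f₁ y * adj (f₂ y)), Finset.sum_mul, Finset.mul_sum]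
    rw [Finset.sum_comm]
    refine Finset.sum_congr rfl fun a _ => Finset.sum_congr rfl fun c _ => ?_
    rw [coeff_mul_eq_sum, agr]
    simp only [coeff_adj, sub_eq_add_neg, neg_add, neg_neg, add_comm, mul_assoc]
  simp only [e]
  rw [Finset.sum_comm]
  simp only [← Finset.sum_mul]
  calc _ ≤ ∑ a, A * ∑ c, m.coeff (c - a) * g.coeff c :=
        Finset.sum_le_sum fun a _ => mul_le_mul_of_nonneg_right (hA _)
          (Finset.sum_nonneg fun c _ => mul_nonneg (hm.1 _) (hg.1 _))
    _ = A := by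
      rw [← Finset.mul_sum, Finset.sum_comm]
      have : ∀ c, ∑ a, m.coeff (c - a) * g.coeff c = g.coeff c := fun c => by
        rw [← Finset.sum_mul, show ∑ a, m.coeff (c - a) = 1 from
          (Equiv.sum_comp (Equiv.subLeft c) m.coeff).trans hm.2, one_mul]
      simp only [this, hg.2, mul_one]

lemma coeff_mul_ge {f g : AddMonoidAlgebra ℝ H} (hf : f ∈ simplex H) (hg : g ∈ simplex H)
    (a b : H) : 1 - (f * g).coeff (a + b) ≤ (1 - f.coeff a) + (1 - g.coeff b) := by
  have h1 : f.coeff a * g.coeff b ≤ (f * g).coeff (a + b) := by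
    rw [coeff_mul_eq_sum]
    have := Finset.single_le_sum (f := fun c => f.coeff c * g.coeff (a + b - c))
      (fun c _ => mul_nonneg (hf.1 _) (hg.1 _)) (Finset.mem_univ a)
    simpa using this
  nlinarith [mul_nonneg (sub_nonneg.2 (IsProb.le_one (mem_simplex_iff.1 hf) a))
    (sub_nonneg.2 (IsProb.le_one (mem_simplex_iff.1 hg) b))]

lemma ip_le_of_ne {f g : AddMonoidAlgebra ℝ H} (hf : f ∈ simplex H) (hg : g ∈ simplex H)
    {a b : H} (hab : a ≠ b) : ip f g ≤ (1 - f.coeff a) + (1 - g.coeff b) := by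
  classical
  have h1 : ip f g ≤ f.coeff b + ∑ c ∈ Finset.univ.erase b, g.coeff c := by
    rw [ip, ← Finset.add_sum_erase _ _ (Finset.mem_univ b)]
    refine add_le_add (mul_le_of_le_one_right (hf.1 b) (IsProb.le_one (mem_simplex_iff.1 hg) b))
      (Finset.sum_le_sum fun c _ => ?_)
    exact mul_le_of_le_one_left (hg.1 c) (IsProb.le_one (mem_simplex_iff.1 hf) c)
  have h2 := Finset.add_sum_erase Finset.univ g.coeff (Finset.mem_univ b)
  have h3 : f.coeff a + f.coeff b ≤ 1 := by
    rw [← hf.2, ← Finset.sum_pair hab]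
    exact Finset.sum_le_univ_sum_of_nonneg hf.1
  rw [hg.2] at h2
  linarith

lemma one_sub_coeff_quad_le {f₁ f₂ f₃ f₄ : AddMonoidAlgebra ℝ H} (h₁ : f₁ ∈ simplex H)
    (h₂ : f₂ ∈ simplex H) (h₃ : f₃ ∈ simplex H) (h₄ : f₄ ∈ simplex H) (a₁ a₂ a₃ a₄ : H) :
    1 - (f₁ * adj f₂ * adj f₃ * f₄).coeff (a₁ - a₂ - a₃ + a₄) ≤
      (1 - f₁.coeff a₁) + (1 - f₂.coeff a₂) + (1 - f₃.coeff a₃) + (1 - f₄.coeff a₄) := by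
  have e₂ := adj_mem_simplex h₂
  have e₃ := adj_mem_simplex h₃
  have k₁ := coeff_mul_ge h₁ e₂ a₁ (-a₂)
  have k₂ := coeff_mul_ge (mul_mem_simplex h₁ e₂) e₃ (a₁ + -a₂) (-a₃)
  have k₃ := coeff_mul_ge (mul_mem_simplex (mul_mem_simplex h₁ e₂) e₃) h₄ (a₁ + -a₂ + -a₃) a₄
  simp only [coeff_adj, neg_neg] at k₁ k₂
  simp only [sub_eq_add_neg] at *
  linarith

end Convolution

/-! ### Values and costs of parallelograms -/

section AlgValue

variable {G H : Type*} [AddCommGroup G] [AddCommGroup H] [Fintype H]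

lemma algValue_mem_simplex {φ : G → G → AddMonoidAlgebra ℝ H} (hφ : ∀ x y, φ x y ∈ simplex H)
    (w h : G) (P : G × G × G) : algValue φ w h P ∈ simplex H :=
  mul_mem_simplex (mul_mem_simplex (mul_mem_simplex (hφ _ _) (adj_mem_simplex (hφ _ _)))
    (adj_mem_simplex (hφ _ _))) (hφ _ _)

lemma algValue_delta (φ : G → G → H) (w h : G) (P : G × G × G) :
    algValue (fun x y => delta (φ x y)) w h P = delta (groupValue φ w h P) := by
  have adj_delta : ∀ a : H, adj (delta a) = delta (-a) := fun a => by
    classical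
    ext b
    simp only [coeff_adj, delta, AddMonoidAlgebra.coeff_single, Finsupp.single_apply,
      neg_eq_iff_eq_neg, eq_neg_iff_add_eq_zero]
  simp only [algValue, groupValue, adj_delta]
  simp only [delta, AddMonoidAlgebra.single_mul_single, mul_one, sub_eq_add_neg]

/-- The cost of a pair of parallelograms for a map into distributions. -/
def cost (φ : G → G → AddMonoidAlgebra ℝ H) (w h : G) (P Q : G × G × G) : ℝ :=
  1 - ip (algValue φ w h P) (algValue φ w h Q)

lemma cost_nonneg {φ : G → G → AddMonoidAlgebra ℝ H} (hφ : ∀ x y, φ x y ∈ simplex H)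
    (w h : G) (P Q : G × G × G) : 0 ≤ cost φ w h P Q :=
  sub_nonneg.2 (ip_le_one (algValue_mem_simplex hφ _ _ _) (algValue_mem_simplex hφ _ _ _))

/-- Here the edge over x slides while its partner edge and Q stay fixed: no fixed distribution can
match the sliding values better than the most popular increment does. -/
lemma sum_cost_ge {φ : G → G → AddMonoidAlgebra ℝ H} (hφ : ∀ x y, φ x y ∈ simplex H)
    (w h x y' : G) (Q : G × G × G) (s : Finset G) {A : ℝ}
    (hA : ∀ v, ∑ y ∈ s, agr (φ x y).coeff (φ x (y + h)).coeff v ≤ A) :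
    s.card - A ≤ ∑ y ∈ s, cost φ w h (x, y, y') Q := by
  have := sum_ip_mul_le s (fun y => φ x y) (fun y => φ x (y + h)) (adj_mem_simplex (hφ (x + w) y'))
    (hφ (x + w) (y' + h)) (algValue_mem_simplex hφ w h Q) hA
  simp only [cost, algValue, Finset.sum_sub_distrib, Finset.sum_const, nsmul_eq_mul, mul_one] at *
  linarith

/-- If φ were concentrated exactly on ψ the cost would be 1; each of the eight vertices loses at
most its own defect. -/
lemma cost_ge_of_ne {φ : G → G → AddMonoidAlgebra ℝ H} (hφ : ∀ x y, φ x y ∈ simplex H)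
    (ψ : G → G → H) {w h : G} {P Q : G × G × G} (hne : groupValue ψ w h P ≠ groupValue ψ w h Q) :
    1 - ((1 - (φ P.1 P.2.1).coeff (ψ P.1 P.2.1)) +
        (1 - (φ P.1 (P.2.1 + h)).coeff (ψ P.1 (P.2.1 + h))) +
        (1 - (φ (P.1 + w) P.2.2).coeff (ψ (P.1 + w) P.2.2)) +
        (1 - (φ (P.1 + w) (P.2.2 + h)).coeff (ψ (P.1 + w) (P.2.2 + h)))) -
      ((1 - (φ Q.1 Q.2.1).coeff (ψ Q.1 Q.2.1)) +
        (1 - (φ Q.1 (Q.2.1 + h)).coeff (ψ Q.1 (Q.2.1 + h))) +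
        (1 - (φ (Q.1 + w) Q.2.2).coeff (ψ (Q.1 + w) Q.2.2)) +
        (1 - (φ (Q.1 + w) (Q.2.2 + h)).coeff (ψ (Q.1 + w) (Q.2.2 + h)))) ≤ cost φ w h P Q := by
  have h1 := ip_le_of_ne (algValue_mem_simplex hφ w h P) (algValue_mem_simplex hφ w h Q) hne
  obtain ⟨x, y, y'⟩ := P
  obtain ⟨x', z, z'⟩ := Q
  have h2 := one_sub_coeff_quad_le (hφ x y) (hφ x (y + h)) (hφ (x + w) y') (hφ (x + w) (y' + h))
    (ψ x y) (ψ x (y + h)) (ψ (x + w) y') (ψ (x + w) (y' + h))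
  have h3 := one_sub_coeff_quad_le (hφ x' z) (hφ x' (z + h)) (hφ (x' + w) z') (hφ (x' + w) (z' + h))
    (ψ x' z) (ψ x' (z + h)) (ψ (x' + w) z') (ψ (x' + w) (z' + h))
  simp only [cost, algValue, groupValue] at *
  linarith

end AlgValue

/-! ### Joint surjectivity of the column maps -/

section Counting

open scoped Classical

variable {F G M : Type*} [Field F] [Fintype F] [AddCommGroup G] [Module F G] [Fintype G]
  [AddCommGroup M] [Module F M] [Fintype M]

lemma card_fiber_mul_card (L : G →ₗ[F] M) (hL : Function.Surjective L) (m : M) :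
    (Finset.univ.filter fun y => L y = m).card * Fintype.card M = Fintype.card G := by
  have h := Finset.card_eq_sum_card_fiberwise (s := Finset.univ) (t := Finset.univ) (f := L)
    (fun _ _ => Finset.mem_coe.2 (Finset.mem_univ _))
  rw [Finset.card_univ] at h
  rw [h, Finset.sum_const_nat (m := (Finset.univ.filter fun y => L y = m).card), mul_comm,
    Finset.card_univ]
  intro m' _
  exact AddMonoidHom.card_fiber_eq_of_mem_range L (hL m') (hL m)

lemma card_fiber_eq_div (L : G →ₗ[F] M) (hL : Function.Surjective L) (m : M)
    [DecidablePred fun y => L y = m] :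
    ((Finset.univ.filter fun y => L y = m).card : ℝ) = Fintype.card G / Fintype.card M := by
  rw [eq_div_iff (by exact_mod_cast Fintype.card_ne_zero), ← card_fiber_mul_card L hL m]
  push_cast
  congr!

lemma card_fiber_le_card_ker {M' : Type*} [AddCommGroup M'] [Module F M'] (L : G →ₗ[F] M')
    (m : M') :
    (Finset.univ.filter fun y => L y = m).card ≤ (Finset.univ.filter fun y => L y = 0).card := by
  by_cases hm : ∃ y, L y = m
  · obtain ⟨y₀, rfl⟩ := hm
    refine Finset.card_le_card_of_injOn (fun y => y - y₀) (fun y hy => ?_)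
      (fun a _ b _ hab => sub_left_injective hab)
    have : L y = L y₀ := by simpa using hy
    simp [this]
  · rw [Finset.filter_false_of_mem fun y _ h => hm ⟨y, h⟩]
    simp

lemma exists_dual_comp_eq_zero {V : Type*} [AddCommGroup V] [Module F V] {L : G →ₗ[F] V}
    (hL : ¬ Function.Surjective L) : ∃ ξ : Module.Dual F V, ξ ≠ 0 ∧ ξ ∘ₗ L = 0 := by
  rw [← LinearMap.range_eq_top] at hL
  obtain ⟨ξ, h0, h⟩ := Submodule.exists_le_ker_of_lt_top _ (lt_top_iff_ne_top.2 hL)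
  exact ⟨ξ, h0, LinearMap.range_le_ker_iff.1 h⟩

instance fintypeLinearMap {V W : Type*} [AddCommGroup V] [Module F V] [Fintype V]
    [AddCommGroup W] [Module F W] [Fintype W] : Fintype (V →ₗ[F] W) :=
  Fintype.ofInjective (fun f => (f : V → W)) DFunLike.coe_injective

lemma card_dual (V : Type*) [AddCommGroup V] [Module F V] [Fintype V] :
    Fintype.card (Module.Dual F V) = Fintype.card V := by
  rw [Module.card_eq_pow_finrank (K := F) (V := Module.Dual F V), Subspace.dual_finrank_eq,
    ← Module.card_eq_pow_finrank]

/-- Every non-zero combination of the components of `β` has small left and right kernels. -/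
def HighRank (T : ℝ) (β : G →ₗ[F] G →ₗ[F] M) : Prop :=
  ∀ ξ : Module.Dual F M, ξ ≠ 0 →
    ((Finset.univ.filter fun x => ξ ∘ₗ β x = 0).card : ℝ) * T ≤ Fintype.card G ∧
    ((Finset.univ.filter fun h => ξ ∘ₗ β.flip h = 0).card : ℝ) * T ≤ Fintype.card G

/-- The linear part of `β` with an added linear term, on the column over `x`. -/
def colMap (β : G →ₗ[F] G →ₗ[F] M) (bR : G →ₗ[F] M) (x : G) : G →ₗ[F] M := β x + bR

/-- The linear parts on several columns together. -/
def jointMap (β : G →ₗ[F] G →ₗ[F] M) (bR : G →ₗ[F] M) {j : ℕ} (x : Fin j → G) :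
    G →ₗ[F] (Fin j → M) := LinearMap.pi fun i => colMap β bR (x i)

variable {β : G →ₗ[F] G →ₗ[F] M} {bR : G →ₗ[F] M} {T : ℝ}

lemma colMap_add_sub (x y z h : G) : colMap β bR (x - y + z) h =
    colMap β bR x h - colMap β bR y h + colMap β bR z h := by
  simp [colMap]
  abel

/-- A map that is not onto is killed by a non-zero functional; this is the union bound over the |M|
functionals. The joint version below is the same argument with |M|^j functionals. -/
lemma card_not_surjective_flip (hβ : HighRank T β) (hT : 0 ≤ T) :
    ((Finset.univ.filter fun h => ¬ Function.Surjective (β.flip h)).card : ℝ) * T ≤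
      Fintype.card M * Fintype.card G := by
  have hsub : (Finset.univ.filter fun h => ¬ Function.Surjective (β.flip h)) ⊆
      (Finset.univ.filter fun ξ : Module.Dual F M => ξ ≠ 0).biUnion
        fun ξ => Finset.univ.filter fun h => ξ ∘ₗ β.flip h = 0 := by
    intro h hh
    obtain ⟨ξ, h1, h2⟩ := exists_dual_comp_eq_zero (Finset.mem_filter.1 hh).2
    exact Finset.mem_biUnion.2 ⟨ξ, by simpa using h1, by simpa using h2⟩
  have h1 := (Finset.card_le_card hsub).trans Finset.card_biUnion_le
  calc _ ≤ ((∑ ξ ∈ Finset.univ.filter fun ξ : Module.Dual F M => ξ ≠ 0,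
        (Finset.univ.filter fun h => ξ ∘ₗ β.flip h = 0).card : ℕ) : ℝ) * T :=
        mul_le_mul_of_nonneg_right (by exact_mod_cast h1) hT
    _ ≤ ∑ ξ ∈ Finset.univ.filter fun ξ : Module.Dual F M => ξ ≠ 0, (Fintype.card G : ℝ) := by
        rw [Nat.cast_sum, Finset.sum_mul]
        exact Finset.sum_le_sum fun ξ hξ => (hβ ξ (Finset.mem_filter.1 hξ).2).2
    _ ≤ ∑ ξ : Module.Dual F M, (Fintype.card G : ℝ) :=
        Finset.sum_le_univ_sum_of_nonneg fun _ => by positivity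
    _ = _ := by simp [← card_dual (F := F) M]

/-- Some component ζ of ξ is non-zero. With all columns but the i-th fixed, the condition is affine
in x_i with linear part x ↦ ζ ∘ β x, so its solutions number at most those of the homogeneous
equation; `bR` only shifts it. -/
lemma card_dual_joint_eq_zero (hβ : HighRank T β) (hT : 0 ≤ T) {j : ℕ}
    {ξ : Module.Dual F (Fin j → M)} (hξ : ξ ≠ 0) :
    ((Finset.univ.filter fun x : Fin j → G => ξ ∘ₗ jointMap β bR x = 0).card : ℝ) * T ≤
      (Fintype.card G : ℝ) ^ j := by
  obtain ⟨i, hi⟩ : ∃ i, ξ ∘ₗ LinearMap.single F (fun _ => M) i ≠ 0 := by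
    by_contra! h0
    exact hξ (LinearMap.pi_ext' fun i => by simpa using h0 i)
  set ζ := ξ ∘ₗ LinearMap.single F (fun _ => M) i with hζ
  let A : Finset G := Finset.univ.filter fun x => ζ ∘ₗ β x = 0
  let L : G →ₗ[F] Module.Dual F G := β.compr₂ ζ
  have hL : ∀ x, L x = ζ ∘ₗ β x := fun x => rfl
  have hfib : ∀ y : {l // l ≠ i} → G,
      (Finset.univ.filter fun a : G =>
        ξ ∘ₗ jointMap β bR ((Equiv.funSplitAt i G).symm (a, y)) = 0).card ≤ A.card := by
    intro y
    have hA : A = Finset.univ.filter fun x => L x = 0 := rfl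
    rw [hA]
    refine (Finset.card_le_card fun a ha => ?_).trans ((card_fiber_le_card_ker L
      (-(ξ ∘ₗ jointMap β bR ((Equiv.funSplitAt i G).symm (0, y))))).trans_eq (by congr))
    have ha := (Finset.mem_filter.1 ha).2
    simp only [Finset.mem_filter, Finset.mem_univ, true_and]
    rw [eq_neg_iff_add_eq_zero, ← ha]
    ext h
    have : jointMap β bR ((Equiv.funSplitAt i G).symm (a, y)) h =
        Pi.single i (β a h) + jointMap β bR ((Equiv.funSplitAt i G).symm (0, y)) h := by
      ext l
      by_cases hl : l = i
      · subst hl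
        simp [jointMap, colMap, Equiv.funSplitAt, Equiv.piSplitAt]
      · simp [jointMap, colMap, Equiv.funSplitAt, Equiv.piSplitAt, hl]
    rw [LinearMap.comp_apply, this, map_add]
    rfl
  have hcard : (Finset.univ.filter fun x : Fin j → G => ξ ∘ₗ jointMap β bR x = 0).card =
      ∑ y : {l // l ≠ i} → G, (Finset.univ.filter fun a : G =>
        ξ ∘ₗ jointMap β bR ((Equiv.funSplitAt i G).symm (a, y)) = 0).card := by
    simp only [Finset.card_filter]
    rw [← Equiv.sum_comp (Equiv.funSplitAt i G).symm, Fintype.sum_prod_type, Finset.sum_comm]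
  have hN : (Fintype.card G) ^ j = Fintype.card G * Fintype.card ({l // l ≠ i} → G) := by
    rw [← Fintype.card_prod, ← Fintype.card_congr (Equiv.funSplitAt i G)]
    simp
  have h2 : (Finset.univ.filter fun x : Fin j → G => ξ ∘ₗ jointMap β bR x = 0).card ≤
      Fintype.card ({l // l ≠ i} → G) * A.card := by
    rw [hcard]
    refine (Finset.sum_le_sum fun y _ => hfib y).trans ?_
    simp
  have h3 := (hβ ζ hi).1
  calc _ ≤ ((Fintype.card ({l // l ≠ i} → G) * A.card : ℕ) : ℝ) * T :=
        mul_le_mul_of_nonneg_right (by exact_mod_cast h2) hT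
    _ = Fintype.card ({l // l ≠ i} → G) * (A.card * T) := by push_cast; ring
    _ ≤ Fintype.card ({l // l ≠ i} → G) * Fintype.card G :=
        mul_le_mul_of_nonneg_left h3 (by positivity)
    _ = _ := by rw [mul_comm]; exact_mod_cast hN.symm

lemma card_not_surjective_joint (hβ : HighRank T β) (hT : 0 ≤ T) (j : ℕ) :
    ((Finset.univ.filter fun x : Fin j → G =>
        ¬ Function.Surjective (jointMap β bR x)).card : ℝ) * T ≤
      (Fintype.card M : ℝ) ^ j * (Fintype.card G : ℝ) ^ j := by
  have hsub : (Finset.univ.filter fun x : Fin j → G => ¬ Function.Surjective (jointMap β bR x)) ⊆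
      (Finset.univ.filter fun ξ : Module.Dual F (Fin j → M) => ξ ≠ 0).biUnion
        fun ξ => Finset.univ.filter fun x => ξ ∘ₗ jointMap β bR x = 0 := by
    intro h hh
    obtain ⟨ξ, h1, h2⟩ := exists_dual_comp_eq_zero (Finset.mem_filter.1 hh).2
    exact Finset.mem_biUnion.2 ⟨ξ, by simpa using h1, by simpa using h2⟩
  have h1 := (Finset.card_le_card hsub).trans Finset.card_biUnion_le
  calc _ ≤ ((∑ ξ ∈ Finset.univ.filter fun ξ : Module.Dual F (Fin j → M) => ξ ≠ 0,
        (Finset.univ.filter fun x => ξ ∘ₗ jointMap β bR x = 0).card : ℕ) : ℝ) * T :=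
        mul_le_mul_of_nonneg_right (by exact_mod_cast h1) hT
    _ ≤ ∑ ξ ∈ Finset.univ.filter fun ξ : Module.Dual F (Fin j → M) => ξ ≠ 0,
          (Fintype.card G : ℝ) ^ j := by
        rw [Nat.cast_sum, Finset.sum_mul]
        exact Finset.sum_le_sum fun ξ hξ =>
          card_dual_joint_eq_zero hβ hT (Finset.mem_filter.1 hξ).2
    _ ≤ ∑ ξ : Module.Dual F (Fin j → M), (Fintype.card G : ℝ) ^ j :=
        Finset.sum_le_univ_sum_of_nonneg fun _ => by positivity
    _ = _ := by
        rw [Finset.sum_const, Finset.card_univ, card_dual]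
        simp

lemma card_not_surjective_col (hβ : HighRank T β) (hT : 0 ≤ T) :
    ((Finset.univ.filter fun x : G => ¬ Function.Surjective (colMap β bR x)).card : ℝ) * T ≤
      Fintype.card M * Fintype.card G := by
  have h := card_not_surjective_joint (bR := bR) hβ hT 1
  rw [pow_one, pow_one] at h
  refine (mul_le_mul_of_nonneg_right ?_ hT).trans h
  rw [Nat.cast_le]
  refine Finset.card_le_card_of_injOn (fun x => ![x]) (fun x hx => ?_)
    (fun a _ b _ hab => congr_fun hab 0)
  simp only [Finset.coe_filter, Finset.mem_univ, true_and, Set.mem_ofPred_eq] at hx ⊢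
  refine fun hs => hx fun m => ?_
  obtain ⟨y, hy⟩ := hs ![m]
  exact ⟨y, congr_fun hy 0⟩

lemma card_not_surjective_triple (hβ : HighRank T β) (hT : 0 ≤ T) :
    ((Finset.univ.filter fun q : G × G × G =>
        ¬ Function.Surjective (jointMap β bR ![q.1, q.2.1, q.2.2])).card : ℝ) * T ≤
      (Fintype.card M : ℝ) ^ 3 * (Fintype.card G : ℝ) ^ 3 := by
  refine (mul_le_mul_of_nonneg_right ?_ hT).trans (card_not_surjective_joint (bR := bR) hβ hT 3)
  rw [Nat.cast_le]
  refine Finset.card_le_card_of_injOn (fun q => ![q.1, q.2.1, q.2.2]) (fun x hx => ?_)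
    (fun a _ b _ hab => ?_)
  · simpa using hx
  · exact Prod.ext (congr_fun hab 0) (Prod.ext (congr_fun hab 1) (congr_fun hab 2))

lemma card_not_surjective_quintuple (hβ : HighRank T β) (hT : 0 ≤ T) :
    ((Finset.univ.filter fun q : G × G × G × G × G => ¬ Function.Surjective
        (jointMap β bR ![q.2.2.1, q.2.2.2.1, q.2.2.2.2, q.1, q.2.1])).card : ℝ) * T ≤
      (Fintype.card M : ℝ) ^ 5 * (Fintype.card G : ℝ) ^ 5 := by
  refine (mul_le_mul_of_nonneg_right ?_ hT).trans (card_not_surjective_joint (bR := bR) hβ hT 5)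
  rw [Nat.cast_le]
  refine Finset.card_le_card_of_injOn
    (fun q => ![q.2.2.1, q.2.2.2.1, q.2.2.2.2, q.1, q.2.1]) (fun x hx => ?_)
    (fun a _ b _ hab => ?_)
  · simpa using hx
  · exact Prod.ext (congr_fun hab 3) (Prod.ext (congr_fun hab 4) (Prod.ext (congr_fun hab 0)
      (Prod.ext (congr_fun hab 1) (congr_fun hab 2))))

end Counting

/-! ### Counting 4-arrangements -/

section Arrangements

open scoped Classical

variable {F G M : Type*} [Field F] [Fintype F] [AddCommGroup G] [Module F G] [Fintype G]
  [AddCommGroup M] [Module F M] [Fintype M]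

/-- The characteristic function of the set of pairs `(x, y)` with `colMap β bR x y = a x`. -/
def bohr (β : G →ₗ[F] G →ₗ[F] M) (bR : G →ₗ[F] M) (a : G → M) (x y : G) : ℝ :=
  if colMap β bR x y = a x then 1 else 0

/-- The indicator of the vertical edges of height `h` over `x` with both ends in the set. -/
def edge (β : G →ₗ[F] G →ₗ[F] M) (bR : G →ₗ[F] M) (a : G → M) (x h y : G) : ℝ :=
  bohr β bR a x y * bohr β bR a x (y + h)

/-- The number of points of the set over `x`. -/
def colCard (β : G →ₗ[F] G →ₗ[F] M) (bR : G →ₗ[F] M) (a : G → M) (x : G) : ℝ :=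
  ∑ y, bohr β bR a x y

/-- The number of vertical edges of height `h` over `x`. -/
def edgeCard (β : G →ₗ[F] G →ₗ[F] M) (bR : G →ₗ[F] M) (a : G → M) (x h : G) : ℝ :=
  ∑ y, edge β bR a x h y

variable {β : G →ₗ[F] G →ₗ[F] M} {bR : G →ₗ[F] M} {a : G → M} {T η : ℝ}

lemma bohr_nonneg (x y : G) : 0 ≤ bohr β bR a x y := by
  unfold bohr; split_ifs <;> simp

lemma bohr_le_one (x y : G) : bohr β bR a x y ≤ 1 := by
  unfold bohr; split_ifs <;> simp

lemma edge_nonneg (x h y : G) : 0 ≤ edge β bR a x h y :=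
  mul_nonneg (bohr_nonneg _ _) (bohr_nonneg _ _)

lemma edge_eq (x h y : G) :
    edge β bR a x h y = if colMap β bR x h = 0 then bohr β bR a x y else 0 := by
  unfold edge bohr
  by_cases h1 : colMap β bR x y = a x
  · by_cases h2 : colMap β bR x h = 0 <;> simp [h1, h2]
  · simp [h1]

lemma edgeCard_eq (x h : G) :
    edgeCard β bR a x h = if colMap β bR x h = 0 then colCard β bR a x else 0 := by
  simp only [edgeCard, edge_eq, colCard]
  split_ifs <;> simp

lemma colCard_nonneg (x : G) : 0 ≤ colCard β bR a x :=
  Finset.sum_nonneg fun _ _ => bohr_nonneg _ _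

lemma colCard_le (x : G) : colCard β bR a x ≤ Fintype.card G := by
  refine (Finset.sum_le_sum fun y _ => bohr_le_one x y).trans ?_
  simp

lemma colCard_eq_card (x : G) : colCard β bR a x =
    (Finset.univ.filter fun y => colMap β bR x y = a x).card := by
  simp [colCard, bohr]

lemma colCard_of_surjective {x : G} (hx : Function.Surjective (colMap β bR x)) :
    colCard β bR a x = Fintype.card G / Fintype.card M := by
  rw [← card_fiber_eq_div _ hx (a x), colCard_eq_card]

lemma edgeCard_nonneg (x h : G) : 0 ≤ edgeCard β bR a x h :=
  Finset.sum_nonneg fun _ _ => edge_nonneg _ _ _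

lemma edgeCard_le (x h : G) : edgeCard β bR a x h ≤ Fintype.card G := by
  rw [edgeCard_eq]
  split_ifs
  · exact colCard_le x
  · positivity

lemma weight_bohr (w h x y y' : G) : weight (bohr β bR a) w h (x, y, y') =
    edge β bR a x h y * edge β bR a (x + w) h y' := by
  simp only [weight, edge]
  ring

lemma weight_bohr_nonneg (w h : G) (P : G × G × G) : 0 ≤ weight (bohr β bR a) w h P := by
  obtain ⟨x, y, y'⟩ := P
  rw [weight_bohr]
  exact mul_nonneg (edge_nonneg _ _ _) (edge_nonneg _ _ _)

lemma sum_weight (w h : G) : ∑ P, weight (bohr β bR a) w h P =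
    ∑ x, edgeCard β bR a x h * edgeCard β bR a (x + w) h := by
  simp only [Fintype.sum_prod_type, weight_bohr, edgeCard, Finset.sum_mul_sum]

lemma surjective_colMap_of_joint {j : ℕ} {x : Fin j → G}
    (hx : Function.Surjective (jointMap β bR x)) (i : Fin j) :
    Function.Surjective (colMap β bR (x i)) := fun m => by
  obtain ⟨y, hy⟩ := hx (fun _ => m)
  exact ⟨y, congr_fun hy i⟩

/-- The column maps are affine in x, so the fourth column adds no condition on h. This is why the
arrangement count has K^7 = K^3 · K^4 in the denominator and not K^8. -/
lemma colMap_fourth (w x x' h : G) : colMap β bR (x' + w) h =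
    colMap β bR x' h - colMap β bR x h + colMap β bR (x + w) h := by
  rw [← colMap_add_sub]
  congr 2
  abel

lemma joint_triple_eq_zero {x y z h : G} : jointMap β bR ![x, y, z] h = 0 ↔
    colMap β bR x h = 0 ∧ colMap β bR y h = 0 ∧ colMap β bR z h = 0 := by
  simp [funext_iff, Fin.forall_fin_succ, jointMap]

lemma surjective_fourth {w x x' : G}
    (hs : Function.Surjective (jointMap β bR ![x, x + w, x'])) :
    Function.Surjective (colMap β bR (x' + w)) := fun m => by
  obtain ⟨h, hh⟩ := hs ![0, 0, m]
  have h0 := congr_fun hh 0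
  have h1 := congr_fun hh 1
  have h2 := congr_fun hh 2
  simp only [jointMap, LinearMap.pi_apply, Matrix.cons_val_zero, Matrix.cons_val_one,
    Matrix.cons_val] at h0 h1 h2
  exact ⟨h, by rw [colMap_fourth w x x', h0, h1, h2]; simp⟩

/-- The number of arrangements with given columns. -/
lemma sum_edgeCard_quad_le (w x x' : G) :
    ∑ h, edgeCard β bR a x h * edgeCard β bR a (x + w) h * (edgeCard β bR a x' h *
      edgeCard β bR a (x' + w) h) ≤
    (Fintype.card G : ℝ) ^ 5 / (Fintype.card M : ℝ) ^ 7 + (Fintype.card G : ℝ) ^ 5 *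
      (if ¬ Function.Surjective (jointMap β bR ![x, x + w, x']) then 1 else 0) := by
  have hK : (0 : ℝ) < Fintype.card M := by exact_mod_cast Fintype.card_pos
  have hN : (0 : ℝ) < Fintype.card G := by exact_mod_cast Fintype.card_pos
  by_cases hs : Function.Surjective (jointMap β bR ![x, x + w, x'])
  · rw [if_neg (not_not.2 hs), mul_zero, add_zero]
    have key : ∀ h, edgeCard β bR a x h * edgeCard β bR a (x + w) h * (edgeCard β bR a x' h *
        edgeCard β bR a (x' + w) h) ≤ if jointMap β bR ![x, x + w, x'] h = 0 then
          ((Fintype.card G : ℝ) / Fintype.card M) ^ 4 else 0 := by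
      intro h
      by_cases hh : jointMap β bR ![x, x + w, x'] h = 0
      · rw [if_pos hh]
        obtain ⟨h1, h2, h3⟩ := joint_triple_eq_zero.1 hh
        have h4 : colMap β bR (x' + w) h = 0 := by rw [colMap_fourth w x x', h1, h2, h3]; simp
        have s0 : Function.Surjective (colMap β bR x) := surjective_colMap_of_joint hs 0
        have s1 : Function.Surjective (colMap β bR (x + w)) := surjective_colMap_of_joint hs 1
        have s2 : Function.Surjective (colMap β bR x') := surjective_colMap_of_joint hs 2
        rw [edgeCard_eq, edgeCard_eq, edgeCard_eq, edgeCard_eq, if_pos h1, if_pos h2, if_pos h3,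
          if_pos h4, colCard_of_surjective s0, colCard_of_surjective s1, colCard_of_surjective s2,
          colCard_of_surjective (surjective_fourth hs)]
        exact le_of_eq (by ring)
      · rw [if_neg hh]
        rw [joint_triple_eq_zero] at hh
        simp only [edgeCard_eq]
        split_ifs <;> simp_all
    refine (Finset.sum_le_sum fun h _ => key h).trans (le_of_eq ?_)
    rw [← Finset.sum_filter, Finset.sum_const, nsmul_eq_mul, card_fiber_eq_div _ hs]
    simp only [Fintype.card_pi, Finset.prod_const, Finset.card_univ, Fintype.card_fin]
    push_cast
    field_simp
  · rw [if_pos hs, mul_one]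
    calc _ ≤ ∑ h : G, (Fintype.card G : ℝ) ^ 4 := by
          refine Finset.sum_le_sum fun h _ => ?_
          have e1 := edgeCard_nonneg (β := β) (bR := bR) (a := a)
          have e2 := edgeCard_le (β := β) (bR := bR) (a := a)
          calc _ ≤ ((Fintype.card G : ℝ) * Fintype.card G) *
                ((Fintype.card G : ℝ) * Fintype.card G) :=
                mul_le_mul (mul_le_mul (e2 _ _) (e2 _ _) (e1 _ _) hN.le)
                  (mul_le_mul (e2 _ _) (e2 _ _) (e1 _ _) hN.le)
                  (mul_nonneg (e1 _ _) (e1 _ _)) (by positivity)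
            _ = _ := by ring
      _ = (Fintype.card G : ℝ) ^ 5 := by
          rw [Finset.sum_const, Finset.card_univ, nsmul_eq_mul]; ring
      _ ≤ _ := le_add_of_nonneg_left (by positivity)

lemma sum_not_surjective_triple (hβ : HighRank T β) (hT : 0 < T) :
    ∑ w : G, ∑ x : G, ∑ x' : G,
      (if ¬ Function.Surjective (jointMap β bR ![x, x + w, x']) then (1 : ℝ) else 0) ≤
      (Fintype.card M : ℝ) ^ 3 * (Fintype.card G : ℝ) ^ 3 / T := by
  rw [le_div_iff₀ hT]
  refine le_of_eq_of_le ?_ (card_not_surjective_triple (bR := bR) hβ hT.le)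
  congr 1
  rw [Finset.sum_comm]
  simp only [Finset.card_filter, Fintype.sum_prod_type, Nat.cast_sum, Nat.cast_ite, Nat.cast_one,
    Nat.cast_zero]
  refine Finset.sum_congr rfl fun x _ => ?_
  exact sum_add_left (fun y => ∑ x' : G,
    (if ¬ Function.Surjective (jointMap β bR ![x, y, x']) then (1 : ℝ) else 0)) x

lemma sum_weight_mul_weight (w h : G) :
    ∑ P, ∑ Q, weight (bohr β bR a) w h P * weight (bohr β bR a) w h Q =
    ∑ x, ∑ x', edgeCard β bR a x h * edgeCard β bR a (x + w) h * (edgeCard β bR a x' h *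
      edgeCard β bR a (x' + w) h) := by
  simp only [← Finset.mul_sum, ← Finset.sum_mul, sum_weight]

/-- The number of 4-arrangements. -/
theorem sum_arrangements_le (hβ : HighRank T β) (hT : 0 < T)
    (hKT : 100 * (Fintype.card M : ℝ) ^ 10 ≤ T) :
    ∑ d : G × G, ∑ P, ∑ Q, weight (bohr β bR a) d.1 d.2 P * weight (bohr β bR a) d.1 d.2 Q ≤
      101 / 100 * ((Fintype.card G : ℝ) ^ 8 / (Fintype.card M : ℝ) ^ 7) := by
  have hK : (0 : ℝ) < Fintype.card M := by exact_mod_cast Fintype.card_pos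
  have hN : (0 : ℝ) < Fintype.card G := by exact_mod_cast Fintype.card_pos
  simp only [sum_weight_mul_weight]
  rw [Fintype.sum_prod_type]
  calc _ = ∑ w : G, ∑ x : G, ∑ x' : G, ∑ h, edgeCard β bR a x h * edgeCard β bR a (x + w) h *
        (edgeCard β bR a x' h * edgeCard β bR a (x' + w) h) := by
        refine Finset.sum_congr rfl fun w _ => ?_
        rw [Finset.sum_comm]
        refine Finset.sum_congr rfl fun x _ => ?_
        rw [Finset.sum_comm]
    _ ≤ ∑ w : G, ∑ x : G, ∑ x' : G, ((Fintype.card G : ℝ) ^ 5 / (Fintype.card M : ℝ) ^ 7 +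
          (Fintype.card G : ℝ) ^ 5 *
          (if ¬ Function.Surjective (jointMap β bR ![x, x + w, x']) then 1 else 0)) :=
        Finset.sum_le_sum fun w _ => Finset.sum_le_sum fun x _ => Finset.sum_le_sum fun x' _ =>
          sum_edgeCard_quad_le w x x'
    _ = (Fintype.card G : ℝ) ^ 8 / (Fintype.card M : ℝ) ^ 7 + (Fintype.card G : ℝ) ^ 5 *
          ∑ w : G, ∑ x : G, ∑ x' : G,
          (if ¬ Function.Surjective (jointMap β bR ![x, x + w, x']) then 1 else 0) := by
        simp only [Finset.sum_add_distrib, Finset.mul_sum, Finset.sum_const, Finset.card_univ,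
          nsmul_eq_mul]
        congr 1
        ring
    _ ≤ (Fintype.card G : ℝ) ^ 8 / (Fintype.card M : ℝ) ^ 7 + (Fintype.card G : ℝ) ^ 5 *
          ((Fintype.card M : ℝ) ^ 3 * (Fintype.card G : ℝ) ^ 3 / T) := by
        gcongr
        exact sum_not_surjective_triple hβ hT
    _ ≤ (Fintype.card G : ℝ) ^ 8 / (Fintype.card M : ℝ) ^ 7 + (Fintype.card G : ℝ) ^ 5 *
          ((Fintype.card M : ℝ) ^ 3 * (Fintype.card G : ℝ) ^ 3 /
            (100 * (Fintype.card M : ℝ) ^ 10)) := by gcongr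
    _ = _ := by field_simp; ring

end Arrangements

/-! ### Concentration of increments on single columns -/

section Columns

open scoped Classical

variable {F G M H : Type*} [Field F] [Fintype F] [AddCommGroup G] [Module F G] [Fintype G]
  [AddCommGroup M] [Module F M] [Fintype M] [AddCommGroup H] [Fintype H]

/-- The total cost of a map over the 4-arrangements. -/
def totalCost (β : G →ₗ[F] G →ₗ[F] M) (bR : G →ₗ[F] M) (a : G → M)
    (φ : G → G → AddMonoidAlgebra ℝ H) : ℝ :=
  ∑ d : G × G, ∑ P, ∑ Q, weight (bohr β bR a) d.1 d.2 P * weight (bohr β bR a) d.1 d.2 Q *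
    cost φ d.1 d.2 P Q

/-- The number of edges of height `h` over `x` along which `φ` increases by `v`. -/
def colAgr (β : G →ₗ[F] G →ₗ[F] M) (bR : G →ₗ[F] M) (a : G → M)
    (φ : G → G → AddMonoidAlgebra ℝ H) (x h : G) (v : H) : ℝ :=
  ∑ y, bohr β bR a x y * agr (φ x y).coeff (φ x (y + h)).coeff v

/-- The number of edges of height `h` over `x` along which `φ` does not increase by `v`. -/
def colDefect (β : G →ₗ[F] G →ₗ[F] M) (bR : G →ₗ[F] M) (a : G → M)
    (φ : G → G → AddMonoidAlgebra ℝ H) (x h : G) (v : H) : ℝ :=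
  if colMap β bR x h = 0 then colCard β bR a x - colAgr β bR a φ x h v else 0

variable {β : G →ₗ[F] G →ₗ[F] M} {bR : G →ₗ[F] M} {a : G → M} {T η : ℝ}
  {φ : G → G → AddMonoidAlgebra ℝ H} {ρ : G → G → H}

lemma colDefect_nonneg (hφ : ∀ x y, φ x y ∈ simplex H) (x h : G) (v : H) :
    0 ≤ colDefect β bR a φ x h v := by
  unfold colDefect
  split_ifs
  · rw [sub_nonneg]
    exact Finset.sum_le_sum fun y _ =>
      mul_le_of_le_one_right (bohr_nonneg _ _) (agr_le_one (hφ _ _) (hφ _ _) v)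
  · exact le_rfl

lemma colDefect_le (hφ : ∀ x y, φ x y ∈ simplex H) (x h : G) (v : H) :
    colDefect β bR a φ x h v ≤ colCard β bR a x := by
  unfold colDefect
  split_ifs
  · exact sub_le_self _ (Finset.sum_nonneg fun y _ =>
      mul_nonneg (bohr_nonneg _ _) (agr_nonneg (hφ _ _) (hφ _ _) v))
  · exact colCard_nonneg x

lemma colDefect_le_sum_cost (hφ : ∀ x y, φ x y ∈ simplex H)
    (hρ : ∀ x h v, colAgr β bR a φ x h v ≤ colAgr β bR a φ x h (ρ x h))
    (w h x y' : G) (Q : G × G × G) :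
    colDefect β bR a φ x h (ρ x h) ≤ ∑ y, edge β bR a x h y * cost φ w h (x, y, y') Q := by
  unfold colDefect
  simp only [edge_eq]
  split_ifs with hh
  · have := sum_cost_ge hφ w h x y' Q (Finset.univ.filter fun y => colMap β bR x y = a x)
      (A := colAgr β bR a φ x h (ρ x h)) (fun v => by
        refine le_of_eq_of_le ?_ (hρ x h v)
        simp [colAgr, bohr, Finset.sum_filter])
    rw [colCard_eq_card]
    refine this.trans (le_of_eq ?_)
    simp [bohr, Finset.sum_filter]
  · simp

/-- `colDefect_le_sum_cost` is applied to one of the four edges; the factor multiplying the defect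
counts the ways of completing that edge to an arrangement, apart from its position y. -/
lemma sum_colDefect_le_totalCost (hφ : ∀ x y, φ x y ∈ simplex H)
    (hρ : ∀ x h v, colAgr β bR a φ x h v ≤ colAgr β bR a φ x h (ρ x h)) :
    ∑ x, ∑ h, colDefect β bR a φ x h (ρ x h) * ∑ w, ∑ x', edgeCard β bR a (x + w) h *
      (edgeCard β bR a x' h * edgeCard β bR a (x' + w) h) ≤ totalCost β bR a φ := by
  have h1 : ∀ w h x, colDefect β bR a φ x h (ρ x h) * (edgeCard β bR a (x + w) h *
      ∑ Q, weight (bohr β bR a) w h Q) ≤ ∑ y, ∑ y', ∑ Q, weight (bohr β bR a) w h (x, y, y') *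
        weight (bohr β bR a) w h Q * cost φ w h (x, y, y') Q := by
    intro w h x
    calc _ = ∑ y', ∑ Q, edge β bR a (x + w) h y' * weight (bohr β bR a) w h Q *
          colDefect β bR a φ x h (ρ x h) := by
          simp only [edgeCard, ← Finset.sum_mul, ← Finset.mul_sum]
          ring
      _ ≤ ∑ y', ∑ Q, edge β bR a (x + w) h y' * weight (bohr β bR a) w h Q *
          ∑ y, edge β bR a x h y * cost φ w h (x, y, y') Q :=
          Finset.sum_le_sum fun y' _ => Finset.sum_le_sum fun Q _ =>
            mul_le_mul_of_nonneg_left (colDefect_le_sum_cost hφ hρ w h x y' Q)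
              (mul_nonneg (edge_nonneg _ _ _) (weight_bohr_nonneg _ _ _))
      _ = _ := by
          simp only [Finset.mul_sum]
          rw [Finset.sum_comm_cycle]
          refine Finset.sum_congr rfl fun y _ => ?_
          refine Finset.sum_congr rfl fun y' _ => Finset.sum_congr rfl fun Q _ => ?_
          rw [weight_bohr w h x y y']
          ring
  calc _ = ∑ w, ∑ h, ∑ x, colDefect β bR a φ x h (ρ x h) * (edgeCard β bR a (x + w) h *
        ∑ Q, weight (bohr β bR a) w h Q) := by
        simp only [sum_weight, Finset.mul_sum]
        rw [Finset.sum_comm]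
        rw [Finset.sum_comm_cycle]
    _ ≤ ∑ w, ∑ h, ∑ x, ∑ y, ∑ y', ∑ Q, weight (bohr β bR a) w h (x, y, y') *
        weight (bohr β bR a) w h Q * cost φ w h (x, y, y') Q :=
        Finset.sum_le_sum fun w _ => Finset.sum_le_sum fun h _ => Finset.sum_le_sum fun x _ =>
          h1 w h x
    _ = _ := by
        rw [totalCost, Fintype.sum_prod_type]
        refine Finset.sum_congr rfl fun w _ => Finset.sum_congr rfl fun h _ => ?_
        rw [Fintype.sum_prod_type]
        refine Finset.sum_congr rfl fun x _ => ?_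
        rw [Fintype.sum_prod_type]

lemma sum_indicator_not_surjective (hβ : HighRank T β) (hT : 0 < T) :
    ∑ x : G, (if ¬ Function.Surjective (colMap β bR x) then (1 : ℝ) else 0) ≤
      Fintype.card M * Fintype.card G / T := by
  rw [le_div_iff₀ hT]
  refine le_of_eq_of_le ?_ (card_not_surjective_col (bR := bR) hβ hT.le)
  rw [Finset.sum_boole]

/-- As x already satisfies the kernel condition at h, only the columns x + w and x' must be asked
to; each condition has density exactly 1/K because `β.flip h` is onto. The indicator s discards
columns of the wrong size, at the cost of three terms of at most one hundredth of the main one. -/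
lemma sum_edgeCard_triple_ge (hβ : HighRank T β) (hT : 0 < T)
    (hKT : 100 * (Fintype.card M : ℝ) ^ 10 ≤ T) {x h : G} (hx : colMap β bR x h = 0)
    (hh : Function.Surjective (β.flip h)) :
    3 / 4 * ((Fintype.card G : ℝ) ^ 5 / (Fintype.card M : ℝ) ^ 5) ≤
      ∑ w, ∑ x', edgeCard β bR a (x + w) h *
      (edgeCard β bR a x' h * edgeCard β bR a (x' + w) h) := by
  have hK : (1 : ℝ) ≤ Fintype.card M := by exact_mod_cast Fintype.card_pos
  have hN : (0 : ℝ) < Fintype.card G := by exact_mod_cast Fintype.card_pos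
  set K : ℝ := (Fintype.card M : ℝ)
  set N : ℝ := (Fintype.card G : ℝ) with hNdef
  let z : G → ℝ := fun x => if colMap β bR x h = 0 then 1 else 0
  let s : G → ℝ := fun x => if ¬ Function.Surjective (colMap β bR x) then 1 else 0
  have hz : ∑ x, z x = N / K := by
    rw [← card_fiber_eq_div _ hh (-bR h)]
    simp only [z, Finset.sum_boole]
    simp only [colMap, eq_neg_iff_add_eq_zero, LinearMap.add_apply, LinearMap.flip_apply]
    congr!
  have hs : ∑ x, s x ≤ K * N / T := sum_indicator_not_surjective hβ hT
  have hpt : ∀ w x', (N / K) ^ 3 * (z (x + w) * z x' - s (x + w) - s x' - s (x' + w)) ≤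
      edgeCard β bR a (x + w) h * (edgeCard β bR a x' h * edgeCard β bR a (x' + w) h) := by
    intro w x'
    have hc : (0 : ℝ) ≤ (N / K) ^ 3 := by positivity
    have hr : 0 ≤ edgeCard β bR a (x + w) h * (edgeCard β bR a x' h *
        edgeCard β bR a (x' + w) h) :=
      mul_nonneg (edgeCard_nonneg _ _) (mul_nonneg (edgeCard_nonneg _ _) (edgeCard_nonneg _ _))
    have hs0 : ∀ x, 0 ≤ s x := fun x => by simp only [s]; split_ifs <;> simp
    have hz1 : ∀ x, z x ≤ 1 := fun x => by simp only [z]; split_ifs <;> simp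
    have hz0 : ∀ x, 0 ≤ z x := fun x => by simp only [z]; split_ifs <;> simp
    have hzz : z (x + w) * z x' ≤ 1 := mul_le_one₀ (hz1 _) (hz0 _) (hz1 _)
    by_cases s1 : Function.Surjective (colMap β bR (x + w))
    swap
    · have : s (x + w) = 1 := if_pos s1
      exact (mul_nonpos_of_nonneg_of_nonpos hc
        (by linarith [hs0 x', hs0 (x' + w)])).trans hr
    by_cases s2 : Function.Surjective (colMap β bR x')
    swap
    · have : s x' = 1 := if_pos s2
      exact (mul_nonpos_of_nonneg_of_nonpos hc
        (by linarith [hs0 (x + w), hs0 (x' + w)])).trans hr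
    by_cases s3 : Function.Surjective (colMap β bR (x' + w))
    swap
    · have : s (x' + w) = 1 := if_pos s3
      exact (mul_nonpos_of_nonneg_of_nonpos hc
        (by linarith [hs0 (x + w), hs0 x'])).trans hr
    have e1 : s (x + w) = 0 := if_neg (not_not.2 s1)
    have e2 : s x' = 0 := if_neg (not_not.2 s2)
    have e3 : s (x' + w) = 0 := if_neg (not_not.2 s3)
    rw [e1, e2, e3, sub_zero, sub_zero, sub_zero]
    by_cases z1 : colMap β bR (x + w) h = 0
    swap
    · have : z (x + w) = 0 := if_neg z1
      rwa [this, zero_mul, mul_zero]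
    by_cases z2 : colMap β bR x' h = 0
    swap
    · have : z x' = 0 := if_neg z2
      rwa [this, mul_zero, mul_zero]
    have z3 : colMap β bR (x' + w) h = 0 := by rw [colMap_fourth w x x', z1, z2, hx]; simp
    have f1 : z (x + w) = 1 := if_pos z1
    have f2 : z x' = 1 := if_pos z2
    rw [f1, f2, edgeCard_eq, edgeCard_eq, edgeCard_eq, if_pos z1, if_pos z2, if_pos z3,
      colCard_of_surjective s1, colCard_of_surjective s2, colCard_of_surjective s3]
    exact le_of_eq (by ring)
  refine le_trans ?_ (Finset.sum_le_sum fun w _ => Finset.sum_le_sum fun x' _ => hpt w x')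
  have e1 : ∑ w, ∑ x', z (x + w) * z x' = (N / K) ^ 2 := by
    rw [← Finset.sum_mul_sum, sum_add_left z x, hz, sq]
  have e2 : ∑ w, ∑ _x' : G, s (x + w) = N * ∑ x, s x := by
    rw [Finset.sum_comm]
    simp only [sum_add_left s x]
    simp [hNdef]
  have e3 : ∑ _w : G, ∑ x', s x' = N * ∑ x, s x := by simp [hNdef]
  have e4 : ∑ w, ∑ x', s (x' + w) = N * ∑ x, s x := by
    simp only [sum_add_right s]
    simp [hNdef]
  simp only [← Finset.mul_sum, Finset.sum_sub_distrib] at e1 e2 e3 e4 ⊢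
  rw [e1, e2, e3, e4]
  have h5 : N * ∑ x, s x ≤ (N / K) ^ 2 * (1 / 100) := by
    calc _ ≤ N * (K * N / T) := by gcongr
      _ ≤ N * (K * N / (100 * K ^ 10)) := by gcongr
      _ = (N / K) ^ 2 * (1 / 100) * (1 / K ^ 7) := by field_simp
      _ ≤ (N / K) ^ 2 * (1 / 100) * 1 := by
          gcongr
          rw [div_le_one (by positivity)]
          exact one_le_pow₀ hK
      _ = _ := mul_one _
  calc _ = (N / K) ^ 3 * (3 / 4 * (N / K) ^ 2) := by field_simp
    _ ≤ _ := by
      gcongr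
      nlinarith [sq_nonneg (N / K)]

/-- On most columns `φ` mostly has the same increments along edges of the same height. -/
theorem sum_colDefect_le (hφ : ∀ x y, φ x y ∈ simplex H)
    (hρ : ∀ x h v, colAgr β bR a φ x h v ≤ colAgr β bR a φ x h (ρ x h))
    (hβ : HighRank T β) (hT : 0 < T) (hη : 0 < η) (hη' : η ≤ 1)
    (hKT : 100 * (Fintype.card M : ℝ) ^ 10 ≤ η * T)
    (hcost : totalCost β bR a φ ≤
      101 / 100 * η * ((Fintype.card G : ℝ) ^ 8 / (Fintype.card M : ℝ) ^ 7)) :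
    ∑ x ∈ Finset.univ.filter fun x => Function.Surjective (colMap β bR x),
      ∑ h, colDefect β bR a φ x h (ρ x h) ≤
      2 * η * ((Fintype.card G : ℝ) ^ 3 / (Fintype.card M : ℝ) ^ 2) := by
  have hKT' : 100 * (Fintype.card M : ℝ) ^ 10 ≤ T := hKT.trans (by nlinarith)
  have hsum := (sum_colDefect_le_totalCost hφ hρ).trans hcost
  have hK : (1 : ℝ) ≤ Fintype.card M := by exact_mod_cast Fintype.card_pos
  have hN : (0 : ℝ) < Fintype.card G := by exact_mod_cast Fintype.card_pos
  have hC : ∀ x h, 0 ≤ ∑ w, ∑ x', edgeCard β bR a (x + w) h *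
      (edgeCard β bR a x' h * edgeCard β bR a (x' + w) h) := fun x h =>
    Finset.sum_nonneg fun w _ => Finset.sum_nonneg fun x' _ =>
      mul_nonneg (edgeCard_nonneg _ _) (mul_nonneg (edgeCard_nonneg _ _) (edgeCard_nonneg _ _))
  have hflip := card_not_surjective_flip hβ hT.le
  set K : ℝ := (Fintype.card M : ℝ)
  set N : ℝ := (Fintype.card G : ℝ) with hNdef
  set S := Finset.univ.filter fun x => Function.Surjective (colMap β bR x)
  set c := 3 / 4 * (N ^ 5 / K ^ 5) with hc
  have hc0 : 0 < c := by positivity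
  have h1 : c * ∑ x ∈ S, ∑ h ∈ Finset.univ.filter fun h => Function.Surjective (β.flip h),
      colDefect β bR a φ x h (ρ x h) ≤ 101 / 100 * η * (N ^ 8 / K ^ 7) := by
    refine le_trans ?_ hsum
    rw [Finset.mul_sum]
    refine (Finset.sum_le_sum fun x _ => ?_).trans
      (Finset.sum_le_univ_sum_of_nonneg fun x => Finset.sum_nonneg fun h _ =>
        mul_nonneg (colDefect_nonneg hφ _ _ _) (hC x h))
    rw [Finset.mul_sum]
    refine (Finset.sum_le_sum fun h hh => ?_).trans
      (Finset.sum_le_univ_sum_of_nonneg fun h =>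
        mul_nonneg (colDefect_nonneg hφ _ _ _) (hC x h))
    by_cases hx : colMap β bR x h = 0
    · rw [mul_comm]
      exact mul_le_mul_of_nonneg_left (sum_edgeCard_triple_ge hβ hT hKT' hx
        (Finset.mem_filter.1 hh).2) (colDefect_nonneg hφ _ _ _)
    · simp [colDefect, hx]
  -- The heights for which `β.flip h` is not onto have no lower bound on completions, but they are
  -- so few that the trivial bound N/K on the defect suffices.
  have h2 : ∑ x ∈ S, ∑ h ∈ Finset.univ.filter fun h => ¬ Function.Surjective (β.flip h),
      colDefect β bR a φ x h (ρ x h) ≤ N * (K * N / T * (N / K)) := by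
    calc _ ≤ ∑ x ∈ S, ∑ h ∈ Finset.univ.filter fun h => ¬ Function.Surjective (β.flip h),
          N / K := by
          refine Finset.sum_le_sum fun x hx => Finset.sum_le_sum fun h _ => ?_
          rw [← colCard_of_surjective (β := β) (bR := bR) (a := a) (Finset.mem_filter.1 hx).2]
          exact colDefect_le hφ x h _
      _ ≤ ∑ x : G, ∑ h ∈ Finset.univ.filter fun h => ¬ Function.Surjective (β.flip h), N / K :=
          Finset.sum_le_univ_sum_of_nonneg fun x => Finset.sum_nonneg fun h _ => by positivity
      _ = N * ((Finset.univ.filter fun h => ¬ Function.Surjective (β.flip h)).card * (N / K)) := by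
          simp [hNdef]
      _ ≤ _ := by
          gcongr
          rwa [le_div_iff₀ hT]
  have h3 : N * (K * N / T * (N / K)) ≤ 1 / 100 * η * (N ^ 3 / K ^ 2) := by
    have : K ^ 2 ≤ 1 / 100 * η * T := by
      have : K ^ 2 ≤ K ^ 10 := pow_le_pow_right₀ hK (by norm_num)
      linarith
    calc _ = N ^ 3 / T := by field_simp
      _ ≤ _ := by
        rw [div_le_iff₀ hT]
        calc N ^ 3 = N ^ 3 / K ^ 2 * K ^ 2 := by field_simp
          _ ≤ N ^ 3 / K ^ 2 * (1 / 100 * η * T) := by gcongr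
          _ = _ := by ring
  have h4 : ∑ x ∈ S, ∑ h ∈ Finset.univ.filter fun h => Function.Surjective (β.flip h),
      colDefect β bR a φ x h (ρ x h) ≤ 4 / 3 * (101 / 100) * η * (N ^ 3 / K ^ 2) := by
    rw [← mul_le_mul_iff_right₀ hc0]
    refine h1.trans (le_of_eq ?_)
    rw [hc]
    field_simp
  have h5 : ∑ x ∈ S, ∑ h, colDefect β bR a φ x h (ρ x h) =
      ∑ x ∈ S, ∑ h ∈ Finset.univ.filter fun h => Function.Surjective (β.flip h),
        colDefect β bR a φ x h (ρ x h) +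
      ∑ x ∈ S, ∑ h ∈ Finset.univ.filter fun h => ¬ Function.Surjective (β.flip h),
        colDefect β bR a φ x h (ρ x h) := by
    rw [← Finset.sum_add_distrib]
    exact Finset.sum_congr rfl fun x _ => (Finset.sum_filter_add_sum_filter_not _ _ _).symm
  have h6 : 0 ≤ η * (N ^ 3 / K ^ 2) := by positivity
  rw [h5]
  linarith

end Columns

/-! ### Affine maps on most columns -/

section ColumnStructure

open scoped Classical

variable {p : ℕ} [Fact p.Prime] {G M H : Type*} [AddCommGroup G] [Module (ZMod p) G] [Fintype G]
  [AddCommGroup M] [Module (ZMod p) M] [Fintype M] [AddCommGroup H] [Module (ZMod p) H] [Fintype H]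
  {β : G →ₗ[ZMod p] G →ₗ[ZMod p] M} {bR : G →ₗ[ZMod p] M} {a : G → M} {T η : ℝ}
  {φ : G → G → AddMonoidAlgebra ℝ H} {ρ : G → G → H}

lemma sum_ite_mem_submodule (V : Submodule (ZMod p) G) (g : G → ℝ) :
    ∑ y, (if y ∈ V then g y else 0) = ∑ v : V, g v := by
  rw [← Finset.sum_filter]
  exact Finset.sum_subtype _ (by simp) g

lemma sum_bohr_mul {x y₀ : G} (hy₀ : colMap β bR x y₀ = a x) (g : G → ℝ) :
    ∑ y, bohr β bR a x y * g y = ∑ v : LinearMap.ker (colMap β bR x), g (y₀ + v) := by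
  rw [← sum_ite_mem_submodule (LinearMap.ker (colMap β bR x)) (fun v => g (y₀ + v)),
    ← sum_add_left _ y₀]
  refine Finset.sum_congr rfl fun y _ => ?_
  simp [bohr, hy₀]

/-- On a column on which `φ` mostly has constant increments, `φ` is mostly affine. -/
lemma exists_affine_on_column (hφ : ∀ x y, φ x y ∈ simplex H) {x : G}
    (hx : Function.Surjective (colMap β bR x)) {ε : ℝ} (hε : ε ≤ 1 / 8)
    (hsum : ∑ h, colDefect β bR a φ x h (ρ x h) ≤
      ε * ((Fintype.card G : ℝ) / Fintype.card M) ^ 2) :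
    ∃ (r : G →ₗ[ZMod p] H) (c : H), ∑ y, bohr β bR a x y * (1 - (φ x y).coeff (r y + c)) ≤
      2 * ε * ((Fintype.card G : ℝ) / Fintype.card M) := by
  obtain ⟨y₀, hy₀⟩ := hx (a x)
  set V := LinearMap.ker (colMap β bR x) with hV
  have hcard : (Fintype.card V : ℝ) = (Fintype.card G : ℝ) / Fintype.card M := by
    rw [← card_fiber_eq_div _ hx 0, Fintype.card_subtype]
    congr!
  -- The column is the coset y₀ + V of the kernel V, and heights outside V contribute 0 to the
  -- defect, so everything becomes a sum over V.
  have e : ∑ h, colDefect β bR a φ x h (ρ x h) = ∑ d : V, ∑ v : V,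
      (1 - agr (φ x (y₀ + v)).coeff (φ x (y₀ + ↑(v + d))).coeff (ρ x d)) := by
    refine Eq.trans ?_ (sum_ite_mem_submodule V (fun d => ∑ v : V,
      (1 - agr (φ x (y₀ + v)).coeff (φ x (y₀ + (v + d))).coeff (ρ x d))))
    refine Finset.sum_congr rfl fun h _ => ?_
    simp only [colDefect, hV, LinearMap.mem_ker]
    split_ifs
    · rw [colCard, colAgr, ← Finset.sum_sub_distrib]
      simp only [← mul_one_sub]
      rw [sum_bohr_mul hy₀]
      simp only [add_assoc]
      congr!
    · rfl
  rw [e, ← hcard] at hsum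
  obtain ⟨r, c, hrc⟩ := exists_affine_of_concentrated_differences
    (f := fun v : V => (φ x (y₀ + v)).coeff) (fun v => hφ _ _) (fun d => ρ x d) hε hsum
  -- The homomorphism lives on V only and any linear extension to G will do; this freedom is what
  -- has to be corrected later by `exists_adjustment`.
  obtain ⟨R, hR⟩ := LinearMap.exists_extend (r.toZModLinearMap p)
  refine ⟨R, c - R y₀, ?_⟩
  rw [sum_bohr_mul hy₀, ← hcard]
  refine le_of_eq_of_le (Finset.sum_congr rfl fun v _ => ?_) hrc
  have : R v = r v := LinearMap.congr_fun hR v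
  rw [map_add R, this, show R y₀ + r v + (c - R y₀) = r v + c by abel]

/-- Most columns carry an affine map with which `φ` mostly agrees. -/
theorem exists_column_maps (hφ : ∀ x y, φ x y ∈ simplex H) (hβ : HighRank T β) (hT : 0 < T)
    (hη : 0 < η) (hη' : η ≤ 1) (hKT : 100 * (Fintype.card M : ℝ) ^ 10 ≤ η * T)
    (hcost : totalCost β bR a φ ≤
      101 / 100 * η * ((Fintype.card G : ℝ) ^ 8 / (Fintype.card M : ℝ) ^ 7)) :
    ∃ (S : Finset G) (r : G → G →ₗ[ZMod p] H) (c : G → H) (δ : G → ℝ),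
      (∀ x ∈ S, Function.Surjective (colMap β bR x)) ∧ (∀ x, 0 ≤ δ x) ∧
      (∀ x ∈ S, ∑ y, bohr β bR a x y * (1 - (φ x y).coeff (r x y + c x)) ≤
        δ x * ((Fintype.card G : ℝ) / Fintype.card M)) ∧
      (∑ x ∈ S, δ x ≤ 4 * η * Fintype.card G) ∧ ((Sᶜ.card : ℝ) ≤ 17 * η * Fintype.card G) := by
  have hK : (1 : ℝ) ≤ Fintype.card M := by exact_mod_cast Fintype.card_pos
  have hN : (0 : ℝ) < Fintype.card G := by exact_mod_cast Fintype.card_pos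
  have hmax : ∀ x h, ∃ v₀, ∀ v, colAgr β bR a φ x h v ≤ colAgr β bR a φ x h v₀ := fun x h =>
    Finite.exists_max _
  choose ρ hρ using hmax
  have hsum := sum_colDefect_le hφ hρ hβ hT hη hη' hKT hcost
  have hns := card_not_surjective_col (bR := bR) hβ hT.le
  set K : ℝ := (Fintype.card M : ℝ)
  set N : ℝ := (Fintype.card G : ℝ)
  set S₀ := Finset.univ.filter fun x => Function.Surjective (colMap β bR x) with hS₀
  let ε : G → ℝ := fun x => (∑ h, colDefect β bR a φ x h (ρ x h)) / (N / K) ^ 2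
  have hε0 : ∀ x, 0 ≤ ε x := fun x =>
    div_nonneg (Finset.sum_nonneg fun h _ => colDefect_nonneg hφ _ _ _) (by positivity)
  have hε : ∑ x ∈ S₀, ε x ≤ 2 * η * N := by
    simp only [ε]
    rw [← Finset.sum_div, div_le_iff₀ (by positivity)]
    refine hsum.trans (le_of_eq ?_)
    field_simp
  -- The threshold is the one required by `exists_affine_on_column`. By Markov's inequality it
  -- excludes at most 16ηN columns, and the columns whose map is not onto account for at most ηN
  -- more.
  let S := S₀.filter fun x => ε x ≤ 1 / 8
  have hex : ∀ x, ∃ (r : G →ₗ[ZMod p] H) (c : H), x ∈ S →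
      ∑ y, bohr β bR a x y * (1 - (φ x y).coeff (r y + c)) ≤ 2 * ε x * (N / K) := by
    intro x
    by_cases hx : x ∈ S
    · obtain ⟨h1, h2⟩ := Finset.mem_filter.1 hx
      obtain ⟨r, c, hrc⟩ := exists_affine_on_column (β := β) (bR := bR) (a := a) (ρ := ρ) hφ
        (Finset.mem_filter.1 h1).2 h2 (div_mul_cancel₀ _ (by positivity)).ge
      exact ⟨r, c, fun _ => hrc⟩
    · exact ⟨0, 0, fun h => absurd h hx⟩
  choose r c hrc using hex
  refine ⟨S, r, c, fun x => 2 * ε x, fun x hx => ?_, fun x => ?_, hrc, ?_, ?_⟩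
  · exact (Finset.mem_filter.1 (Finset.mem_filter.1 hx).1).2
  · have := hε0 x
    positivity
  · rw [← Finset.mul_sum]
    have := (Finset.sum_le_sum_of_subset_of_nonneg (Finset.filter_subset (fun x => ε x ≤ 1 / 8) S₀)
      (fun x _ _ => hε0 x)).trans hε
    linarith
  · have h1 : Sᶜ ⊆ (S₀.filter fun x => ¬ ε x ≤ 1 / 8) ∪
        Finset.univ.filter fun x => ¬ Function.Surjective (colMap β bR x) := by
      intro x hx
      simp only [S, hS₀, Finset.mem_compl, Finset.mem_filter, Finset.mem_univ, true_and,
        Finset.mem_union] at hx ⊢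
      tauto
    have h2 : (Sᶜ.card : ℝ) ≤ (S₀.filter fun x => ¬ ε x ≤ 1 / 8).card +
        (Finset.univ.filter fun x => ¬ Function.Surjective (colMap β bR x)).card := by
      exact_mod_cast (Finset.card_le_card h1).trans (Finset.card_union_le _ _)
    have h3 : ((S₀.filter fun x => ¬ ε x ≤ 1 / 8).card : ℝ) * (1 / 8) ≤ 2 * η * N := by
      refine le_trans ?_ hε
      rw [← nsmul_eq_mul]
      refine (Finset.card_nsmul_le_sum _ _ _ fun x hx => ?_).trans
        (Finset.sum_le_sum_of_subset_of_nonneg (Finset.filter_subset (fun x => ¬ ε x ≤ 1 / 8) S₀)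
          (fun x _ _ => hε0 x))
      exact (not_le.1 (Finset.mem_filter.1 hx).2).le
    have h4 : ((Finset.univ.filter fun x =>
        ¬ Function.Surjective (colMap β bR x)).card : ℝ) ≤ η * N := by
      rw [← mul_le_mul_iff_left₀ hT]
      refine hns.trans ?_
      have : K ≤ K ^ 10 := le_self_pow₀ hK (by norm_num)
      nlinarith
    linarith

end ColumnStructure

/-! ### Additive quadruples of columns -/

section Quadruples

open scoped Classical

variable {p : ℕ} [Fact p.Prime] {G M H : Type*} [AddCommGroup G] [Module (ZMod p) G] [Fintype G]
  [AddCommGroup M] [Module (ZMod p) M] [Fintype M] [AddCommGroup H] [Module (ZMod p) H] [Fintype H]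

/-- The linear maps `r x` respect the additive quadruple `(x, y, z, x - y + z)`. -/
def GoodQuad (β : G →ₗ[ZMod p] G →ₗ[ZMod p] M) (bR : G →ₗ[ZMod p] M) (r : G → G →ₗ[ZMod p] H)
    (x y z : G) : Prop :=
  ∀ h, colMap β bR x h = 0 → colMap β bR y h = 0 → colMap β bR z h = 0 →
    r x h - r y h + r z h - r (x - y + z) h = 0

/-- The indicator of the additive quadruples that are not good. -/
def badQuad (β : G →ₗ[ZMod p] G →ₗ[ZMod p] M) (bR : G →ₗ[ZMod p] M) (r : G → G →ₗ[ZMod p] H)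
    (x y z : G) : ℝ := if GoodQuad β bR r x y z then 0 else 1

/-- The cost of the arrangements with given columns. -/
def quadCost (β : G →ₗ[ZMod p] G →ₗ[ZMod p] M) (bR : G →ₗ[ZMod p] M) (a : G → M)
    (φ : G → G → AddMonoidAlgebra ℝ H) (w x x' : G) : ℝ :=
  ∑ h, ∑ y, ∑ y', ∑ z, ∑ z', edge β bR a x h y * edge β bR a (x + w) h y' *
    (edge β bR a x' h z * edge β bR a (x' + w) h z') * cost φ w h (x, y, y') (x', z, z')

variable {β : G →ₗ[ZMod p] G →ₗ[ZMod p] M} {bR : G →ₗ[ZMod p] M} {a : G → M} {T η : ℝ}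
  {φ : G → G → AddMonoidAlgebra ℝ H} {r : G → G →ₗ[ZMod p] H}

lemma badQuad_nonneg (x y z : G) : 0 ≤ badQuad β bR r x y z := by
  unfold badQuad; split_ifs <;> simp

lemma edgeProd_cost_nonneg (hφ : ∀ x y, φ x y ∈ simplex H) (w x x' h y y' z z' : G) :
    0 ≤ edge β bR a x h y * edge β bR a (x + w) h y' *
    (edge β bR a x' h z * edge β bR a (x' + w) h z') * cost φ w h (x, y, y') (x', z, z') :=
  mul_nonneg (mul_nonneg (mul_nonneg (edge_nonneg _ _ _) (edge_nonneg _ _ _))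
    (mul_nonneg (edge_nonneg _ _ _) (edge_nonneg _ _ _))) (cost_nonneg hφ _ _ _ _)

lemma quadCost_nonneg (hφ : ∀ x y, φ x y ∈ simplex H) (w x x' : G) :
    0 ≤ quadCost β bR a φ w x x' :=
  Finset.sum_nonneg fun _ _ => Finset.sum_nonneg fun _ _ => Finset.sum_nonneg fun _ _ =>
    Finset.sum_nonneg fun _ _ => Finset.sum_nonneg fun _ _ => edgeProd_cost_nonneg hφ _ _ _ _ _ _ _ _

lemma totalCost_eq_sum_quadCost :
    totalCost β bR a φ = ∑ w, ∑ x, ∑ x', quadCost β bR a φ w x x' := by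
  rw [totalCost, Fintype.sum_prod_type]
  refine Finset.sum_congr rfl fun w _ => ?_
  simp only [quadCost]
  calc _ = ∑ h, ∑ x, ∑ x', ∑ y, ∑ y', ∑ z, ∑ z', edge β bR a x h y * edge β bR a (x + w) h y' *
        (edge β bR a x' h z * edge β bR a (x' + w) h z') *
        cost φ w h (x, y, y') (x', z, z') := by
        refine Finset.sum_congr rfl fun h _ => ?_
        simp only [Fintype.sum_prod_type, weight_bohr]
        refine Finset.sum_congr rfl fun x _ => ?_
        rw [Finset.sum_comm_cycle]
    _ = _ := by
        rw [Finset.sum_comm]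
        refine Finset.sum_congr rfl fun x _ => ?_
        rw [Finset.sum_comm]

lemma sum_four_mul_one_sub (g₁ g₂ g₃ g₄ u₁ u₂ u₃ u₄ : G → ℝ) :
    ∑ y, ∑ y', ∑ z, ∑ z', g₁ y * g₂ y' * (g₃ z * g₄ z') *
      (1 - u₁ y - u₂ y' - u₃ z - u₄ z') =
    (∑ y, g₁ y) * (∑ y, g₂ y) * ((∑ y, g₃ y) * ∑ y, g₄ y) -
    (∑ y, g₁ y * u₁ y) * (∑ y, g₂ y) * ((∑ y, g₃ y) * ∑ y, g₄ y) -
    (∑ y, g₁ y) * (∑ y, g₂ y * u₂ y) * ((∑ y, g₃ y) * ∑ y, g₄ y) -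
    (∑ y, g₁ y) * (∑ y, g₂ y) * ((∑ y, g₃ y * u₃ y) * ∑ y, g₄ y) -
    (∑ y, g₁ y) * (∑ y, g₂ y) * ((∑ y, g₃ y) * ∑ y, g₄ y * u₄ y) := by
  have e : ∀ f₁ f₂ f₃ f₄ : G → ℝ, ∑ y, ∑ y', ∑ z, ∑ z', f₁ y * f₂ y' * (f₃ z * f₄ z') =
      (∑ y, f₁ y) * (∑ y, f₂ y) * ((∑ y, f₃ y) * ∑ y, f₄ y) := by
    intro f₁ f₂ f₃ f₄
    simp only [← Finset.mul_sum, ← Finset.sum_mul]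
  simp only [← e, ← Finset.sum_sub_distrib]
  refine Finset.sum_congr rfl fun _ _ => Finset.sum_congr rfl fun _ _ =>
    Finset.sum_congr rfl fun _ _ => Finset.sum_congr rfl fun _ _ => ?_
  ring

/-- Translation by h₀ maps the zeros of D in the kernel of L injectively to its non-zeros. -/
lemma card_half_le {V : Type*} [AddCommGroup V] [Module (ZMod p) V] [Fintype V]
    (L : G →ₗ[ZMod p] V) (hL : Function.Surjective L) (D : G →ₗ[ZMod p] H) {h₀ : G}
    (h1 : L h₀ = 0) (h2 : D h₀ ≠ 0) : (Fintype.card G : ℝ) / Fintype.card V / 2 ≤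
      (Finset.univ.filter fun h => L h = 0 ∧ D h ≠ 0).card := by
  have hle : (Finset.univ.filter fun h => L h = 0 ∧ D h = 0).card ≤
      (Finset.univ.filter fun h => L h = 0 ∧ D h ≠ 0).card := by
    refine Finset.card_le_card_of_injOn (fun h => h + h₀) (fun h hh => ?_)
      (fun a _ b _ hab => add_left_injective _ hab)
    have := (Finset.mem_filter.1 hh).2
    simp [this.1, this.2, h1, h2]
  have heq : (Finset.univ.filter fun h => L h = 0).card =
      (Finset.univ.filter fun h => L h = 0 ∧ D h = 0).card +
      (Finset.univ.filter fun h => L h = 0 ∧ D h ≠ 0).card := by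
    rw [← Finset.filter_filter, ← Finset.filter_filter, Finset.card_filter_add_card_filter_not]
  rw [← card_fiber_eq_div L hL 0, heq]
  have : ((Finset.univ.filter fun h => L h = 0 ∧ D h = 0).card : ℝ) ≤
      (Finset.univ.filter fun h => L h = 0 ∧ D h ≠ 0).card := by exact_mod_cast hle
  push_cast
  linarith

variable {S : Finset G} {c : G → H} {δ : G → ℝ}

lemma bohr_add {x h : G} (hh : colMap β bR x h = 0) (y : G) :
    bohr β bR a x (y + h) = bohr β bR a x y := by
  simp [bohr, hh]

lemma sum_bohr_defect_le {x h : G} (hh : colMap β bR x h = 0) {d : G → ℝ} {n : ℝ}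
    (hd : ∑ y, bohr β bR a x y * d y ≤ n) :
    ∑ y, bohr β bR a x y * (d y + d (y + h)) ≤ 2 * n := by
  have : ∑ y, bohr β bR a x y * d (y + h) = ∑ y, bohr β bR a x y * d y := by
    rw [← sum_add_right (fun y => bohr β bR a x y * d y) h]
    simp only [bohr_add hh]
  simp only [mul_add, Finset.sum_add_distrib, this]
  linarith

/-- At each of at least half of the N/K^3 heights in the common kernel, the affine models give the
two parallelograms different values whatever y, y', z, z' are. The cost is then 1 up to the defects
of φ, and each column carries two vertices of the arrangement, hence 2δ. -/
lemma quadCost_ge (hφ : ∀ x y, φ x y ∈ simplex H)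
    (hS : ∀ x ∈ S, Function.Surjective (colMap β bR x))
    (hd : ∀ x ∈ S, ∑ y, bohr β bR a x y * (1 - (φ x y).coeff (r x y + c x)) ≤
        δ x * ((Fintype.card G : ℝ) / Fintype.card M))
    {w x x' : G} (hs : Function.Surjective (jointMap β bR ![x, x + w, x'])) (h₁ : x ∈ S)
    (h₂ : x + w ∈ S) (h₃ : x' ∈ S) (h₄ : x' + w ∈ S) (hbad : ¬ GoodQuad β bR r (x + w) x x') :
    (Fintype.card G : ℝ) ^ 5 / (Fintype.card M : ℝ) ^ 7 / 2 *
      (1 - 2 * (δ x + δ (x + w) + δ x' + δ (x' + w))) ≤ quadCost β bR a φ w x x' := by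
  have hK : (0 : ℝ) < Fintype.card M := by exact_mod_cast Fintype.card_pos
  have hN : (0 : ℝ) < Fintype.card G := by exact_mod_cast Fintype.card_pos
  rcases le_or_gt (1 - 2 * (δ x + δ (x + w) + δ x' + δ (x' + w))) 0 with hneg | hpos
  · exact (mul_nonpos_of_nonneg_of_nonpos (by positivity) hneg).trans (quadCost_nonneg hφ _ _ _)
  let D : G →ₗ[ZMod p] H := r (x + w) - r x + r x' - r (x' + w)
  obtain ⟨h₀, hL, hD⟩ : ∃ h, jointMap β bR ![x, x + w, x'] h = 0 ∧ D h ≠ 0 := by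
    unfold GoodQuad at hbad
    push Not at hbad
    obtain ⟨h, k1, k2, k3, k4⟩ := hbad
    refine ⟨h, joint_triple_eq_zero.2 ⟨k2, k1, k3⟩, ?_⟩
    rw [show x + w - x + x' = x' + w by abel] at k4
    exact k4
  have hhalf := card_half_le _ hs D hL hD
  simp only [Fintype.card_pi, Finset.prod_const, Finset.card_univ, Fintype.card_fin] at hhalf
  push_cast at hhalf
  have hinner : ∀ h ∈ Finset.univ.filter fun h => jointMap β bR ![x, x + w, x'] h = 0 ∧ D h ≠ 0,
      ((Fintype.card G : ℝ) / Fintype.card M) ^ 4 *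
        (1 - 2 * (δ x + δ (x + w) + δ x' + δ (x' + w))) ≤
      ∑ y, ∑ y', ∑ z, ∑ z', edge β bR a x h y * edge β bR a (x + w) h y' *
        (edge β bR a x' h z * edge β bR a (x' + w) h z') *
        cost φ w h (x, y, y') (x', z, z') := by
    intro h hh
    obtain ⟨hj, hDh⟩ := (Finset.mem_filter.1 hh).2
    obtain ⟨k1, k2, k3⟩ := joint_triple_eq_zero.1 hj
    have k4 : colMap β bR (x' + w) h = 0 := by rw [colMap_fourth w x x', k1, k2, k3]; simp
    let d : G → G → ℝ := fun x y => 1 - (φ x y).coeff (r x y + c x)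
    have hcst : ∀ y y' z z', 1 - (d x y + d x (y + h)) - (d (x + w) y' + d (x + w) (y' + h)) -
        (d x' z + d x' (z + h)) - (d (x' + w) z' + d (x' + w) (z' + h)) ≤
        cost φ w h (x, y, y') (x', z, z') := by
      intro y y' z z'
      have := cost_ge_of_ne hφ (fun x y => r x y + c x) (w := w) (h := h) (P := (x, y, y'))
        (Q := (x', z, z')) (by
          simp only [groupValue, map_add]
          intro heq
          apply hDh
          simp only [D, LinearMap.sub_apply, LinearMap.add_apply]
          rw [← sub_eq_zero] at heq
          rw [← heq]
          abel)
      simp only [d]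
      linarith
    have hg : ∀ x, colMap β bR x h = 0 → ∀ y, edge β bR a x h y = bohr β bR a x y :=
      fun x hx y => by rw [edge_eq, if_pos hx]
    have b1 := sum_bohr_defect_le k1 (hd x h₁)
    have b2 := sum_bohr_defect_le k2 (hd _ h₂)
    have b3 := sum_bohr_defect_le k3 (hd _ h₃)
    have b4 := sum_bohr_defect_le k4 (hd _ h₄)
    have n1 : ∑ y, bohr β bR a x y = _ := colCard_of_surjective (hS _ h₁)
    have n2 : ∑ y, bohr β bR a (x + w) y = _ := colCard_of_surjective (hS _ h₂)
    have n3 : ∑ y, bohr β bR a x' y = _ := colCard_of_surjective (hS _ h₃)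
    have n4 : ∑ y, bohr β bR a (x' + w) y = _ := colCard_of_surjective (hS _ h₄)
    calc _ ≤ ∑ y, ∑ y', ∑ z, ∑ z', bohr β bR a x y * bohr β bR a (x + w) y' *
          (bohr β bR a x' z * bohr β bR a (x' + w) z') *
          (1 - (d x y + d x (y + h)) - (d (x + w) y' + d (x + w) (y' + h)) -
          (d x' z + d x' (z + h)) - (d (x' + w) z' + d (x' + w) (z' + h))) := by
          rw [sum_four_mul_one_sub (bohr β bR a x) (bohr β bR a (x + w)) (bohr β bR a x')
            (bohr β bR a (x' + w)) (fun y => d x y + d x (y + h))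
            (fun y => d (x + w) y + d (x + w) (y + h)) (fun y => d x' y + d x' (y + h))
            (fun y => d (x' + w) y + d (x' + w) (y + h)), n1, n2, n3, n4]
          set n := (Fintype.card G : ℝ) / Fintype.card M with hn
          have hn0 : 0 ≤ n ^ 3 := by positivity
          have m1 := mul_le_mul_of_nonneg_left b1 hn0
          have m2 := mul_le_mul_of_nonneg_left b2 hn0
          have m3 := mul_le_mul_of_nonneg_left b3 hn0
          have m4 := mul_le_mul_of_nonneg_left b4 hn0
          simp only [d]
          linarith
      _ ≤ _ := by
          refine Finset.sum_le_sum fun y _ => Finset.sum_le_sum fun y' _ =>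
            Finset.sum_le_sum fun z _ => Finset.sum_le_sum fun z' _ => ?_
          rw [hg _ k1, hg _ k2, hg _ k3, hg _ k4]
          exact mul_le_mul_of_nonneg_left (hcst y y' z z')
            (mul_nonneg (mul_nonneg (bohr_nonneg _ _) (bohr_nonneg _ _))
              (mul_nonneg (bohr_nonneg _ _) (bohr_nonneg _ _)))
  have hsum := Finset.card_nsmul_le_sum _ _ _ hinner
  refine le_trans ?_ (hsum.trans (Finset.sum_le_univ_sum_of_nonneg fun h =>
    Finset.sum_nonneg fun _ _ => Finset.sum_nonneg fun _ _ => Finset.sum_nonneg fun _ _ =>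
      Finset.sum_nonneg fun _ _ => edgeProd_cost_nonneg hφ _ _ _ _ _ _ _ _))
  rw [nsmul_eq_mul]
  calc _ = (Fintype.card G : ℝ) / (Fintype.card M : ℝ) ^ 3 / 2 *
        (((Fintype.card G : ℝ) / Fintype.card M) ^ 4 *
        (1 - 2 * (δ x + δ (x + w) + δ x' + δ (x' + w)))) := by field_simp
    _ ≤ _ := mul_le_mul_of_nonneg_right hhalf (by positivity)

/-- Most additive quadruples of columns are good. -/
theorem sum_badQuad_le (hφ : ∀ x y, φ x y ∈ simplex H) (hβ : HighRank T β) (hT : 0 < T)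
    (hη : 0 < η) (hKT : 100 * (Fintype.card M : ℝ) ^ 10 ≤ η * T)
    (hcost : totalCost β bR a φ ≤
      101 / 100 * η * ((Fintype.card G : ℝ) ^ 8 / (Fintype.card M : ℝ) ^ 7))
    (hS : ∀ x ∈ S, Function.Surjective (colMap β bR x)) (hδ : ∀ x, 0 ≤ δ x)
    (hd : ∀ x ∈ S, ∑ y, bohr β bR a x y * (1 - (φ x y).coeff (r x y + c x)) ≤
        δ x * ((Fintype.card G : ℝ) / Fintype.card M))
    (hδS : ∑ x ∈ S, δ x ≤ 4 * η * Fintype.card G) (hSc : (Sᶜ.card : ℝ) ≤ 17 * η * Fintype.card G) :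
    ∑ x, ∑ y, ∑ z, badQuad β bR r x y z ≤ 105 * η * (Fintype.card G : ℝ) ^ 3 := by
  have hK : (1 : ℝ) ≤ Fintype.card M := by exact_mod_cast Fintype.card_pos
  have hN : (0 : ℝ) < Fintype.card G := by exact_mod_cast Fintype.card_pos
  have hns := sum_not_surjective_triple (bR := bR) hβ hT
  set K : ℝ := (Fintype.card M : ℝ)
  set N : ℝ := (Fintype.card G : ℝ) with hNdef
  -- The weight of a column: twice its defect if it is in S, otherwise 1, which makes the pointwise
  -- bound trivial. The total is (2·4 + 17)ηN = 25ηN. With four columns, the cost term 2.02 and the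
  -- non-surjective triples this gives 103.02, within 105.
  let s : G → ℝ := fun x => (if x ∈ S then 2 * δ x else 0) + if x ∈ S then 0 else 1
  have hs0 : ∀ x, 0 ≤ s x := fun x => by
    have := hδ x
    simp only [s]; split_ifs <;> simp [this]
  have hsum : ∑ x, s x ≤ 25 * η * N := by
    have e1 : ∑ x, (if x ∈ S then 2 * δ x else 0) = 2 * ∑ x ∈ S, δ x := by
      rw [Finset.mul_sum]; simp
    have e2 : ∑ x, (if x ∈ S then (0 : ℝ) else 1) = Sᶜ.card := by
      rw [← Finset.sum_compl_add_sum S, Finset.sum_congr rfl (g := fun _ => (1 : ℝ))]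
      · rw [Finset.sum_congr rfl (g := fun _ => (0 : ℝ)) (fun x hx => if_pos hx)]
        simp
      · exact fun x hx => if_neg (Finset.mem_compl.1 hx)
    simp only [s, Finset.sum_add_distrib, e1, e2]
    linarith
  have hpt : ∀ w x x', badQuad β bR r (x + w) x x' ≤
      2 * K ^ 7 / N ^ 5 * quadCost β bR a φ w x x' + (s x + s (x + w) + s x' + s (x' + w)) +
      (if ¬ Function.Surjective (jointMap β bR ![x, x + w, x']) then 1 else 0) := by
    intro w x x'
    have hq : 0 ≤ 2 * K ^ 7 / N ^ 5 * quadCost β bR a φ w x x' :=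
      mul_nonneg (by positivity) (quadCost_nonneg hφ _ _ _)
    have k1 := hs0 x
    have k2 := hs0 (x + w)
    have k3 := hs0 x'
    have k4 := hs0 (x' + w)
    by_cases hgood : GoodQuad β bR r (x + w) x x'
    · rw [badQuad, if_pos hgood]
      split_ifs <;> linarith
    rw [badQuad, if_neg hgood]
    by_cases hs : Function.Surjective (jointMap β bR ![x, x + w, x'])
    swap
    · rw [if_pos hs]; linarith
    rw [if_neg (not_not.2 hs)]
    have sn : ∀ x, x ∉ S → s x = 1 := fun x hx => by simp [s, hx]
    have sp : ∀ x, x ∈ S → s x = 2 * δ x := fun x hx => by simp [s, hx]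
    by_cases h₁ : x ∈ S
    swap
    · rw [sn x h₁]; linarith
    by_cases h₂ : x + w ∈ S
    swap
    · rw [sn _ h₂]; linarith
    by_cases h₃ : x' ∈ S
    swap
    · rw [sn _ h₃]; linarith
    by_cases h₄ : x' + w ∈ S
    swap
    · rw [sn _ h₄]; linarith
    rw [sp _ h₁, sp _ h₂, sp _ h₃, sp _ h₄]
    have hge := quadCost_ge hφ hS hd hs h₁ h₂ h₃ h₄ hgood
    have hm := mul_le_mul_of_nonneg_left hge (show 0 ≤ 2 * K ^ 7 / N ^ 5 by positivity)
    have he : 2 * K ^ 7 / N ^ 5 * (N ^ 5 / K ^ 7 / 2 *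
        (1 - 2 * (δ x + δ (x + w) + δ x' + δ (x' + w)))) =
        1 - 2 * (δ x + δ (x + w) + δ x' + δ (x' + w)) := by field_simp
    linarith
  have hre : ∑ x, ∑ y, ∑ z, badQuad β bR r x y z =
      ∑ w, ∑ x, ∑ x', badQuad β bR r (x + w) x x' := by
    rw [Finset.sum_comm]
    conv_rhs => rw [Finset.sum_comm]
    exact Finset.sum_congr rfl fun x _ =>
      (sum_add_left (fun y => ∑ x', badQuad β bR r y x x') x).symm
  rw [hre]
  refine (Finset.sum_le_sum fun w _ => Finset.sum_le_sum fun x _ =>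
    Finset.sum_le_sum fun x' _ => hpt w x x').trans ?_
  simp only [Finset.sum_add_distrib, ← Finset.mul_sum]
  rw [← totalCost_eq_sum_quadCost]
  have t1 : ∑ _w : G, ∑ x, ∑ _x' : G, s x = N ^ 2 * ∑ x, s x := by
    simp only [Finset.sum_const, Finset.card_univ, nsmul_eq_mul, ← Finset.mul_sum]
    ring
  have t2 : ∑ w : G, ∑ x, ∑ _x' : G, s (x + w) = N ^ 2 * ∑ x, s x := by
    simp only [Finset.sum_const, Finset.card_univ, nsmul_eq_mul, ← Finset.mul_sum, sum_add_right s]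
    ring
  have t3 : ∑ _w : G, ∑ _x : G, ∑ x', s x' = N ^ 2 * ∑ x, s x := by
    simp only [Finset.sum_const, Finset.card_univ, nsmul_eq_mul]
    ring
  have t4 : ∑ w : G, ∑ _x : G, ∑ x', s (x' + w) = N ^ 2 * ∑ x, s x := by
    simp only [Finset.sum_const, Finset.card_univ, nsmul_eq_mul, sum_add_right s]
    ring
  rw [t1, t2, t3, t4]
  have u1 : 2 * K ^ 7 / N ^ 5 * totalCost β bR a φ ≤ 101 / 50 * η * N ^ 3 := by
    refine (mul_le_mul_of_nonneg_left hcost (by positivity)).trans (le_of_eq ?_)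
    field_simp
    ring
  have u2 : N ^ 2 * ∑ x, s x ≤ 25 * η * N ^ 3 := by
    refine (mul_le_mul_of_nonneg_left hsum (by positivity)).trans (le_of_eq ?_)
    ring
  have u3 : K ^ 3 * N ^ 3 / T ≤ η * N ^ 3 := by
    rw [div_le_iff₀ hT]
    have : K ^ 3 ≤ K ^ 10 := pow_le_pow_right₀ hK (by norm_num)
    have : K ^ 3 ≤ η * T := by nlinarith [pow_pos (lt_of_lt_of_le one_pos hK) 10]
    calc K ^ 3 * N ^ 3 ≤ η * T * N ^ 3 := by gcongr
      _ = _ := by ring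
  have u4 : 0 ≤ η * N ^ 3 := by positivity
  linarith

end Quadruples

/-! ### Adjusting the linear maps on the columns -/

section Cocycle

open scoped Classical

variable {p : ℕ} [Fact p.Prime] {G M H : Type*} [AddCommGroup G] [Module (ZMod p) G] [Fintype G]
  [AddCommGroup M] [Module (ZMod p) M] [Fintype M] [AddCommGroup H] [Module (ZMod p) H] [Fintype H]

lemma exists_comp_eq_of_ker_le {F V W X : Type*} [Field F] [AddCommGroup V] [Module F V]
    [AddCommGroup W] [Module F W] [AddCommGroup X] [Module F X] (L : V →ₗ[F] W) (D : V →ₗ[F] X)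
    (h : LinearMap.ker L ≤ LinearMap.ker D) : ∃ e : W →ₗ[F] X, e ∘ₗ L = D := by
  obtain ⟨e, he⟩ := LinearMap.exists_extend
    ((LinearMap.ker L).liftQ D h ∘ₗ L.quotKerEquivRange.symm.toLinearMap)
  refine ⟨e, LinearMap.ext fun v => ?_⟩
  have := LinearMap.congr_fun he ⟨L v, v, rfl⟩
  simp only [LinearMap.comp_apply, Submodule.subtype_apply, LinearEquiv.coe_coe] at this ⊢
  rw [this, show (⟨L v, v, rfl⟩ : LinearMap.range L) = L.quotKerEquivRange
    (Submodule.Quotient.mk v) from rfl, LinearEquiv.symm_apply_apply]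
  rfl

variable {β : G →ₗ[ZMod p] G →ₗ[ZMod p] M} {bR : G →ₗ[ZMod p] M} {T η : ℝ}
  {r : G → G →ₗ[ZMod p] H}

/-- A linear map that vanishes on the common kernel factors through the three column maps together.
The sign in front of v is chosen to match the alternating pattern of the quadruple. -/
lemma GoodQuad.exists_coeffs {x y z : G} (h : GoodQuad β bR r x y z) :
    ∃ u v w : M →ₗ[ZMod p] H, ∀ g, r x g - r y g + r z g - r (x - y + z) g =
      u (colMap β bR x g) - v (colMap β bR y g) + w (colMap β bR z g) := by
  obtain ⟨e, he⟩ := exists_comp_eq_of_ker_le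
    ((colMap β bR x).prod ((colMap β bR y).prod (colMap β bR z)))
    (r x - r y + r z - r (x - y + z)) (fun g hg => by
      have hg := LinearMap.mem_ker.1 hg
      exact h g (congr_arg Prod.fst hg) (congr_arg (fun q => q.2.1) hg)
        (congr_arg (fun q => q.2.2) hg))
  refine ⟨e ∘ₗ LinearMap.inl _ _ _, -(e ∘ₗ LinearMap.inr _ _ _ ∘ₗ LinearMap.inl _ _ _),
    e ∘ₗ LinearMap.inr _ _ _ ∘ₗ LinearMap.inr _ _ _, fun g => ?_⟩
  have h1 : e (colMap β bR x g, colMap β bR y g, colMap β bR z g) =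
      r x g - r y g + r z g - r (x - y + z) g := LinearMap.congr_fun he g
  rw [← h1]
  simp only [LinearMap.comp_apply, LinearMap.neg_apply, LinearMap.inl_apply, LinearMap.inr_apply,
    sub_neg_eq_add, ← map_add]
  simp

/-- Combinations of the linear parts on independent columns have unique coefficients. -/
lemma coeffs_unique {x₁ x₂ x₃ x₄ x₅ : G}
    (hs : Function.Surjective (jointMap β bR ![x₁, x₂, x₃, x₄, x₅]))
    {u₁ u₂ u₃ u₄ u₅ v₁ v₂ v₃ v₄ v₅ : M →ₗ[ZMod p] H}
    (h : ∀ g, u₁ (colMap β bR x₁ g) - u₂ (colMap β bR x₂ g) + u₃ (colMap β bR x₃ g) -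
        u₄ (colMap β bR x₄ g) + u₅ (colMap β bR x₅ g) =
      v₁ (colMap β bR x₁ g) - v₂ (colMap β bR x₂ g) + v₃ (colMap β bR x₃ g) -
        v₄ (colMap β bR x₄ g) + v₅ (colMap β bR x₅ g)) :
    u₁ = v₁ ∧ u₂ = v₂ ∧ u₃ = v₃ ∧ u₄ = v₄ ∧ u₅ = v₅ := by
  have key : ∀ m : Fin 5 → M, u₁ (m 0) - u₂ (m 1) + u₃ (m 2) - u₄ (m 3) + u₅ (m 4) =
      v₁ (m 0) - v₂ (m 1) + v₃ (m 2) - v₄ (m 3) + v₅ (m 4) := by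
    intro m
    obtain ⟨g, rfl⟩ := hs m
    exact h g
  refine ⟨LinearMap.ext fun m => ?_, LinearMap.ext fun m => ?_, LinearMap.ext fun m => ?_,
    LinearMap.ext fun m => ?_, LinearMap.ext fun m => ?_⟩
  · simpa using key ![m, 0, 0, 0, 0]
  · simpa using key ![0, m, 0, 0, 0]
  · simpa using key ![0, 0, m, 0, 0]
  · simpa using key ![0, 0, 0, m, 0]
  · simpa using key ![0, 0, 0, 0, m]

/-- The linear maps on the columns can be adjusted, by maps that vanish on the kernels, in such a
way that they satisfy an additive relation. -/
lemma exists_adjustment (r : G → G →ₗ[ZMod p] H) (b a : G) :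
    ∃ (F₁ F₂ : G → G →ₗ[ZMod p] H) (s : G → M →ₗ[ZMod p] H), ∀ x₁ x₂ x₃,
      Function.Surjective (jointMap β bR ![x₁, x₂, x₃, b, a]) →
      GoodQuad β bR r x₁ x₂ x₃ → GoodQuad β bR r (x₁ - x₂ + x₃ - b + a) a b →
      GoodQuad β bR r x₁ b a → GoodQuad β bR r x₃ x₂ (x₁ - b + a) →
      GoodQuad β bR r x₃ b a → GoodQuad β bR r x₁ x₂ (x₃ - b + a) →
      GoodQuad β bR r x₂ a b → GoodQuad β bR r x₁ (x₂ - a + b) x₃ →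
      F₁ x₁ - F₂ x₂ + (r x₃ - s x₃ ∘ₗ colMap β bR x₃) - F₂ (x₁ - x₂ + x₃ - b + a) = r b - r a := by
  have h1 : ∀ x, ∃ P Q O : M →ₗ[ZMod p] H, GoodQuad β bR r x b a → ∀ g,
      r x g - r b g + r a g - r (x - b + a) g =
        P (colMap β bR x g) - Q (colMap β bR b g) + O (colMap β bR a g) := fun x => by
    by_cases h : GoodQuad β bR r x b a
    · obtain ⟨P, Q, O, hh⟩ := h.exists_coeffs
      exact ⟨P, Q, O, fun _ => hh⟩
    · exact ⟨0, 0, 0, fun h' => absurd h' h⟩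
  have h2 : ∀ x, ∃ P Q O : M →ₗ[ZMod p] H, GoodQuad β bR r x a b → ∀ g,
      r x g - r a g + r b g - r (x - a + b) g =
        P (colMap β bR x g) - O (colMap β bR a g) + Q (colMap β bR b g) := fun x => by
    by_cases h : GoodQuad β bR r x a b
    · obtain ⟨P, O, Q, hh⟩ := h.exists_coeffs
      exact ⟨P, Q, O, fun _ => hh⟩
    · exact ⟨0, 0, 0, fun h' => absurd h' h⟩
  choose P Q O hPQO using h1
  choose P' Q' O' hPQO' using h2
  refine ⟨fun x => r x - (P x - O x) ∘ₗ colMap β bR x + (Q x - O x) ∘ₗ colMap β bR b,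
    fun x => r x - (P' x - O' x) ∘ₗ colMap β bR x, fun x => P x - O x, ?_⟩
  intro x₁ x₂ x₃ hs hA1 hA2 hB1 hB2 hC1 hC2 hD1 hD2
  set x₆ := x₁ - x₂ + x₃ - b + a with hx₆
  have m₆ : ∀ g, colMap β bR x₆ g = colMap β bR x₁ g - colMap β bR x₂ g + colMap β bR x₃ g -
      colMap β bR b g + colMap β bR a g := fun g => by
    rw [hx₆, colMap_add_sub, colMap_add_sub]
  -- A, B, C, D are the four splittings of the six-term relation x₁ - x₂ + x₃ - b + a = x₆ into two
  -- quadruples. In B, C, D one of the quadruples is made of b, a and a single one of x₁, x₃, x₂, so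
  -- its coefficients depend on that variable alone; in A the same holds for x₆.
  obtain ⟨α₁, α₂, α₃, hA⟩ := hA1.exists_coeffs
  obtain ⟨β₁, β₂, β₃, hB⟩ := hB2.exists_coeffs
  obtain ⟨γ₁, γ₂, γ₃, hC⟩ := hC2.exists_coeffs
  obtain ⟨δ₁, δ₂, δ₃, hD⟩ := hD2.exists_coeffs
  replace hA1 := hPQO' x₆ hA2
  replace hB1 := hPQO x₁ hB1
  replace hC1 := hPQO x₃ hC1
  replace hD1 := hPQO' x₂ hD1
  rw [show x₆ - a + b = x₁ - x₂ + x₃ by rw [hx₆]; abel] at hA1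
  rw [show x₃ - x₂ + (x₁ - b + a) = x₆ by rw [hx₆]; abel] at hB
  rw [show x₁ - x₂ + (x₃ - b + a) = x₆ by rw [hx₆]; abel] at hC
  rw [show x₁ - (x₂ - a + b) + x₃ = x₆ by rw [hx₆]; abel] at hD
  simp only [colMap_add_sub] at hB hC hD
  have rC : ∀ g, r x₁ g - r x₂ g + r x₃ g - r b g + r a g - r x₆ g =
      γ₁ (colMap β bR x₁ g) - γ₂ (colMap β bR x₂ g) + (P x₃ + γ₃) (colMap β bR x₃ g) -
        (Q x₃ + γ₃) (colMap β bR b g) + (O x₃ + γ₃) (colMap β bR a g) := fun g => by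
    have e : r x₁ g - r x₂ g + r x₃ g - r b g + r a g - r x₆ g =
      (r x₃ g - r b g + r a g - r (x₃ - b + a) g) +
        (r x₁ g - r x₂ g + r (x₃ - b + a) g - r x₆ g) := by abel
    rw [e, hC1, hC]
    simp only [map_sub, map_add, LinearMap.add_apply]
    abel
  have rB : ∀ g, r x₁ g - r x₂ g + r x₃ g - r b g + r a g - r x₆ g =
      (P x₁ + β₃) (colMap β bR x₁ g) - β₂ (colMap β bR x₂ g) + β₁ (colMap β bR x₃ g) -
        (Q x₁ + β₃) (colMap β bR b g) + (O x₁ + β₃) (colMap β bR a g) := fun g => by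
    have e : r x₁ g - r x₂ g + r x₃ g - r b g + r a g - r x₆ g =
      (r x₁ g - r b g + r a g - r (x₁ - b + a) g) +
        (r x₃ g - r x₂ g + r (x₁ - b + a) g - r x₆ g) := by abel
    rw [e, hB1, hB]
    simp only [map_sub, map_add, LinearMap.add_apply]
    abel
  have rD : ∀ g, r x₁ g - r x₂ g + r x₃ g - r b g + r a g - r x₆ g =
      δ₁ (colMap β bR x₁ g) - (P' x₂ + δ₂) (colMap β bR x₂ g) + δ₃ (colMap β bR x₃ g) -
        (Q' x₂ + δ₂) (colMap β bR b g) + (O' x₂ + δ₂) (colMap β bR a g) := fun g => by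
    have e : r x₁ g - r x₂ g + r x₃ g - r b g + r a g - r x₆ g =
      (r x₁ g - r (x₂ - a + b) g + r x₃ g - r x₆ g) -
        (r x₂ g - r a g + r b g - r (x₂ - a + b) g) := by abel
    rw [e, hD1, hD]
    simp only [map_sub, map_add, LinearMap.add_apply]
    abel
  have rA : ∀ g, r x₁ g - r x₂ g + r x₃ g - r b g + r a g - r x₆ g =
      (α₁ - P' x₆) (colMap β bR x₁ g) - (α₂ - P' x₆) (colMap β bR x₂ g) +
        (α₃ - P' x₆) (colMap β bR x₃ g) -
        (Q' x₆ - P' x₆) (colMap β bR b g) + (O' x₆ - P' x₆) (colMap β bR a g) := fun g => by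
    have e : r x₁ g - r x₂ g + r x₃ g - r b g + r a g - r x₆ g =
      (r x₁ g - r x₂ g + r x₃ g - r (x₁ - x₂ + x₃) g) -
        (r x₆ g - r a g + r b g - r (x₁ - x₂ + x₃) g) := by abel
    rw [e, hA1, hA, m₆]
    simp only [map_sub, map_add, LinearMap.sub_apply]
    abel
  -- The coefficients of each splitting are compared with those of A. Subtracting the coefficient at
  -- a removes the unknown contribution of the other quadruple (β₃, γ₃ or δ₂), leaving functions of
  -- x₁, x₃ and x₂ alone.
  obtain ⟨c1, -, -, c4, c5⟩ := coeffs_unique hs fun g => (rB g).symm.trans (rA g)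
  obtain ⟨-, -, e3, -, e5⟩ := coeffs_unique hs fun g => (rC g).symm.trans (rA g)
  obtain ⟨-, f2, -, -, f5⟩ := coeffs_unique hs fun g => (rD g).symm.trans (rA g)
  have s1 : P x₁ - O x₁ = (α₁ - P' x₆) - (O' x₆ - P' x₆) := by rw [← c1, ← c5]; abel
  have s4 : Q x₁ - O x₁ = (Q' x₆ - P' x₆) - (O' x₆ - P' x₆) := by rw [← c4, ← c5]; abel
  have s3 : P x₃ - O x₃ = (α₃ - P' x₆) - (O' x₆ - P' x₆) := by rw [← e3, ← e5]; abel
  have s2 : P' x₂ - O' x₂ = (α₂ - P' x₆) - (O' x₆ - P' x₆) := by rw [← f2, ← f5]; abel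
  beta_reduce
  rw [s1, s2, s3, s4]
  refine LinearMap.ext fun g => ?_
  -- The coefficient at a in A is `O' x₆ - P' x₆`. Since the column map at x₆ is the alternating sum
  -- of the other five, moving this multiple of it to the left gives exactly the adjusted map `F₂
  -- x₆`.
  have hr := rA g
  rw [← sub_eq_zero] at hr ⊢
  rw [← hr]
  simp only [LinearMap.add_apply, LinearMap.sub_apply, LinearMap.comp_apply, m₆, map_sub, map_add]
  abel

end Cocycle

/-! ### From additive relations to an affine family -/

section AffineFamily

open scoped Classical

variable {p : ℕ} [Fact p.Prime] {G M H : Type*} [AddCommGroup G] [Module (ZMod p) G] [Fintype G]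
  [AddCommGroup M] [Module (ZMod p) M] [Fintype M] [AddCommGroup H] [Module (ZMod p) H] [Fintype H]
  {β : G →ₗ[ZMod p] G →ₗ[ZMod p] M} {bR : G →ₗ[ZMod p] M} {T η : ℝ}
  {r : G → G →ₗ[ZMod p] H}

lemma sum_three_reverse (g : G → G → G → ℝ) :
    ∑ x, ∑ y, ∑ z, g z y x = ∑ x, ∑ y, ∑ z, g x y z := by
  rw [Finset.sum_comm_cycle]
  exact Finset.sum_congr rfl fun z _ => Finset.sum_comm

lemma sum_three_rotate (g : G → G → G → ℝ) :
    ∑ x, ∑ y, ∑ z, g z x y = ∑ x, ∑ y, ∑ z, g x y z := Finset.sum_comm_cycle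

/-- For each of the linear images of the quintuples that occur in `exists_adjustment`, the sum of
a function of the image. -/
lemma sum_quintuple (g : G → G → G → ℝ) :
    (∑ b : G, ∑ a : G, ∑ x₁, ∑ x₂, ∑ x₃,
      (g x₁ x₂ x₃ + g (x₁ - x₂ + x₃ - b + a) a b + g x₁ b a + g x₃ x₂ (x₁ - b + a) + g x₃ b a +
        g x₁ x₂ (x₃ - b + a) + g x₂ a b + g x₁ (x₂ - a + b) x₃)) =
      8 * (Fintype.card G : ℝ) ^ 2 * ∑ x, ∑ y, ∑ z, g x y z := by
  have c : ∀ t : ℝ, ∑ _x : G, t = Fintype.card G * t := fun t => by simp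
  have e1 : ∑ _b : G, ∑ _a : G, ∑ x₁, ∑ x₂, ∑ x₃, g x₁ x₂ x₃ =
      (Fintype.card G : ℝ) ^ 2 * ∑ x, ∑ y, ∑ z, g x y z := by simp only [c]; ring
  have e2 : ∑ b : G, ∑ a : G, ∑ x₁ : G, ∑ x₂ : G, ∑ x₃, g (x₁ - x₂ + x₃ - b + a) a b =
      (Fintype.card G : ℝ) ^ 2 * ∑ x, ∑ y, ∑ z, g x y z := by
    have : ∀ b a x₁ x₂ : G, ∑ x₃, g (x₁ - x₂ + x₃ - b + a) a b = ∑ x₃, g x₃ a b :=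
      fun b a x₁ x₂ => by
        rw [← sum_add_left (fun x => g x a b) (x₁ - x₂ - b + a)]
        exact Finset.sum_congr rfl fun x _ => by congr 1; abel
    simp only [this, c, ← Finset.mul_sum]
    rw [sum_three_reverse]
    ring
  have e3 : ∑ b : G, ∑ a : G, ∑ x₁, ∑ _x₂ : G, ∑ _x₃ : G, g x₁ b a =
      (Fintype.card G : ℝ) ^ 2 * ∑ x, ∑ y, ∑ z, g x y z := by
    simp only [c, ← Finset.mul_sum]
    rw [sum_three_rotate]
    ring
  have e4 : ∑ b : G, ∑ a : G, ∑ x₁, ∑ x₂, ∑ x₃, g x₃ x₂ (x₁ - b + a) =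
      (Fintype.card G : ℝ) ^ 2 * ∑ x, ∑ y, ∑ z, g x y z := by
    have : ∀ b a : G, ∑ x₁, ∑ x₂, ∑ x₃, g x₃ x₂ (x₁ - b + a) = ∑ x, ∑ y, ∑ z, g z y x :=
      fun b a => by
        rw [← sum_add_right (fun x => ∑ y, ∑ z, g z y x) (-b + a)]
        simp only [sub_eq_add_neg, add_assoc]
    simp only [this, c]
    rw [sum_three_reverse]
    ring
  have e5 : ∑ b : G, ∑ a : G, ∑ _x₁ : G, ∑ _x₂ : G, ∑ x₃, g x₃ b a =
      (Fintype.card G : ℝ) ^ 2 * ∑ x, ∑ y, ∑ z, g x y z := by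
    simp only [c, ← Finset.mul_sum]
    rw [sum_three_rotate]
    ring
  have e6 : ∑ b : G, ∑ a : G, ∑ x₁, ∑ x₂, ∑ x₃, g x₁ x₂ (x₃ - b + a) =
      (Fintype.card G : ℝ) ^ 2 * ∑ x, ∑ y, ∑ z, g x y z := by
    have : ∀ b a x₁ x₂ : G, ∑ x₃, g x₁ x₂ (x₃ - b + a) = ∑ z, g x₁ x₂ z :=
      fun b a x₁ x₂ => by
        rw [← sum_add_right (fun z => g x₁ x₂ z) (-b + a)]
        simp only [sub_eq_add_neg, add_assoc]
    simp only [this, c]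
    ring
  have e7 : ∑ b : G, ∑ a : G, ∑ _x₁ : G, ∑ x₂, ∑ _x₃ : G, g x₂ a b =
      (Fintype.card G : ℝ) ^ 2 * ∑ x, ∑ y, ∑ z, g x y z := by
    simp only [c, ← Finset.mul_sum]
    rw [sum_three_reverse]
    ring
  have e8 : ∑ b : G, ∑ a : G, ∑ x₁, ∑ x₂, ∑ x₃, g x₁ (x₂ - a + b) x₃ =
      (Fintype.card G : ℝ) ^ 2 * ∑ x, ∑ y, ∑ z, g x y z := by
    have : ∀ b a x₁ : G, ∑ x₂, ∑ x₃, g x₁ (x₂ - a + b) x₃ = ∑ y, ∑ z, g x₁ y z :=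
      fun b a x₁ => by
        rw [← sum_add_right (fun y => ∑ z, g x₁ y z) (-a + b)]
        simp only [sub_eq_add_neg, add_assoc]
    simp only [this, c]
    ring
  simp only [Finset.sum_add_distrib]
  rw [e1, e2, e3, e4, e5, e6, e7, e8]
  ring

/-- If four functions on `G` satisfy an additive relation on most triples, then the increments of
the third are mostly constant. -/
lemma exists_affine_of_relation {A : Type*} [AddCommGroup A] [Fintype A] (F₁ F₂ F₃ F₄ : G → A)
    (k : A) (t : G) {ε : ℝ} (hε : ε ≤ 1 / 16)
    (h : ∑ x₁, ∑ x₂, ∑ x₃, (if F₁ x₁ - F₂ x₂ + F₃ x₃ - F₄ (x₁ - x₂ + x₃ + t) = k then (0 : ℝ)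
      else 1) ≤ ε * (Fintype.card G : ℝ) ^ 3) :
    ∃ (L : G →+ A) (c : A), ∑ x, (if F₃ x = L x + c then (0 : ℝ) else 1) ≤
      4 * ε * Fintype.card G := by
  -- With x₁ fixed, F₄ sees only x₃ - x₂. Shifting x₂ and x₃ by the same d and subtracting the two
  -- relations gives F₃(y+d) - F₃(y) = F₂(x₂+d) - F₂(x₂), which does not depend on y.
  obtain ⟨x₁, hx₁⟩ := exists_le_of_sum_le_card_mul (c := ε * (Fintype.card G : ℝ) ^ 2)
    (h.trans (le_of_eq (by ring)))
  let e : G → G → ℝ := fun x₂ x₃ =>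
    if F₁ x₁ - F₂ x₂ + F₃ x₃ - F₄ (x₁ - x₂ + x₃ + t) = k then (0 : ℝ) else 1
  have he0 : ∀ x y, 0 ≤ e x y := fun x y => by simp only [e]; split_ifs <;> simp
  have hd : ∀ d, ∃ v, ∑ y, (if F₃ (y + d) = F₃ y + v then (0 : ℝ) else 1) ≤
      2 * ε * Fintype.card G := by
    intro d
    have h1 : ∑ x₂, ∑ x₃, (e x₂ x₃ + e (x₂ + d) (x₃ + d)) ≤
        Fintype.card G * (2 * ε * Fintype.card G) := by
      have h2 : ∑ x₂, ∑ x₃, e (x₂ + d) (x₃ + d) = ∑ x₂, ∑ x₃, e x₂ x₃ := by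
        rw [← sum_add_right (fun x => ∑ z, e x z) d]
        exact Finset.sum_congr rfl fun x _ => sum_add_right (fun z => e (x + d) z) d
      simp only [Finset.sum_add_distrib, h2]
      simp only [e]
      linarith
    obtain ⟨x₂, hx₂⟩ := exists_le_of_sum_le_card_mul h1
    refine ⟨F₂ (x₂ + d) - F₂ x₂, (Finset.sum_le_sum fun y _ => ?_).trans hx₂⟩
    by_cases k1 : F₁ x₁ - F₂ x₂ + F₃ y - F₄ (x₁ - x₂ + y + t) = k
    swap
    · have : e x₂ y = 1 := if_neg k1
      have := he0 (x₂ + d) (y + d)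
      split_ifs <;> linarith
    by_cases k2 : F₁ x₁ - F₂ (x₂ + d) + F₃ (y + d) - F₄ (x₁ - (x₂ + d) + (y + d) + t) = k
    swap
    · have : e (x₂ + d) (y + d) = 1 := if_neg k2
      have := he0 x₂ y
      split_ifs <;> linarith
    rw [if_pos]
    · exact add_nonneg (he0 _ _) (he0 _ _)
    · rw [show x₁ - (x₂ + d) + (y + d) + t = x₁ - x₂ + y + t by abel, ← k1] at k2
      have k3 := sub_eq_zero.2 k2
      rw [← sub_eq_zero, ← k3]
      abel
  choose ρ hρ using hd
  let f : G → A → ℝ := fun y v => if v = F₃ y then 1 else 0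
  have hf : ∀ y, IsProb (f y) := fun y =>
    ⟨fun v => by simp only [f]; split_ifs <;> simp, by simp [f]⟩
  obtain ⟨L, c, hL⟩ := exists_affine_of_concentrated_differences hf ρ (ε := 2 * ε)
    (by linarith) (by
      calc _ ≤ ∑ d : G, 2 * ε * Fintype.card G := by
            refine Finset.sum_le_sum fun d _ => le_of_eq_of_le ?_ (hρ d)
            refine Finset.sum_congr rfl fun y _ => ?_
            have : agr (f y) (f (y + d)) (ρ d) = if F₃ (y + d) = F₃ y + ρ d then 1 else 0 := by
              rw [agr, Finset.sum_eq_single (F₃ y) (fun v _ hv => by simp [f, hv]) (by simp)]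
              simp [f, eq_comm]
            rw [this]
            split_ifs <;> simp
        _ = _ := by simp; ring)
  refine ⟨L, c, le_of_eq_of_le (Finset.sum_congr rfl fun y _ => ?_)
    (hL.trans (le_of_eq (by ring)))⟩
  simp only [f, eq_comm (a := F₃ y)]
  split_ifs <;> simp

/-- If most additive quadruples are good, then most of the linear maps on the columns come from
one affine family. -/
theorem exists_affine_family (hβ : HighRank T β) (hT : 0 < T) (hη : 0 < η)
    (hη' : η ≤ 1 / 27000) (hKT : 100 * (Fintype.card M : ℝ) ^ 10 ≤ η * T)
    (hbad : ∑ x, ∑ y, ∑ z, badQuad β bR r x y z ≤ 105 * η * (Fintype.card G : ℝ) ^ 3) :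
    ∃ (L : G →ₗ[ZMod p] G →ₗ[ZMod p] H) (R : G →ₗ[ZMod p] H) (s : G → M →ₗ[ZMod p] H),
      ∑ x, (if r x - s x ∘ₗ colMap β bR x = L x + R then (0 : ℝ) else 1) ≤
        3364 * η * Fintype.card G := by
  have hN : (0 : ℝ) < Fintype.card G := by exact_mod_cast Fintype.card_pos
  have hK : (1 : ℝ) ≤ Fintype.card M := by exact_mod_cast Fintype.card_pos
  choose F₁ F₂ s hF using exists_adjustment (β := β) (bR := bR) r
  let e : G → G → G → G → G → ℝ := fun b a x₁ x₂ x₃ =>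
    if F₁ b a x₁ - F₂ b a x₂ + (r x₃ - s b a x₃ ∘ₗ colMap β bR x₃) -
      F₂ b a (x₁ - x₂ + x₃ - b + a) = r b - r a then 0 else 1
  let g := badQuad β bR r
  have hpt : ∀ b a x₁ x₂ x₃, e b a x₁ x₂ x₃ ≤
      (g x₁ x₂ x₃ + g (x₁ - x₂ + x₃ - b + a) a b + g x₁ b a + g x₃ x₂ (x₁ - b + a) + g x₃ b a +
        g x₁ x₂ (x₃ - b + a) + g x₂ a b + g x₁ (x₂ - a + b) x₃) +
      (if ¬ Function.Surjective (jointMap β bR ![x₁, x₂, x₃, b, a]) then 1 else 0) := by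
    intro b a x₁ x₂ x₃
    have g0 : ∀ x y z, 0 ≤ g x y z := badQuad_nonneg
    have gg : ∀ x y z, GoodQuad β bR r x y z ∨ g x y z = 1 := fun x y z => by
      by_cases h : GoodQuad β bR r x y z
      · exact Or.inl h
      · exact Or.inr (if_neg h)
    have k1 := g0 x₁ x₂ x₃
    have k2 := g0 (x₁ - x₂ + x₃ - b + a) a b
    have k3 := g0 x₁ b a
    have k4 := g0 x₃ x₂ (x₁ - b + a)
    have k5 := g0 x₃ b a
    have k6 := g0 x₁ x₂ (x₃ - b + a)
    have k7 := g0 x₂ a b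
    have k8 := g0 x₁ (x₂ - a + b) x₃
    have he1 : e b a x₁ x₂ x₃ ≤ 1 := by simp only [e]; split_ifs <;> simp
    by_cases hs : Function.Surjective (jointMap β bR ![x₁, x₂, x₃, b, a])
    swap
    · rw [if_pos hs]; linarith
    rw [if_neg (not_not.2 hs), add_zero]
    rcases gg x₁ x₂ x₃ with m1 | m1
    swap
    · linarith
    rcases gg (x₁ - x₂ + x₃ - b + a) a b with m2 | m2
    swap
    · linarith
    rcases gg x₁ b a with m3 | m3
    swap
    · linarith
    rcases gg x₃ x₂ (x₁ - b + a) with m4 | m4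
    swap
    · linarith
    rcases gg x₃ b a with m5 | m5
    swap
    · linarith
    rcases gg x₁ x₂ (x₃ - b + a) with m6 | m6
    swap
    · linarith
    rcases gg x₂ a b with m7 | m7
    swap
    · linarith
    rcases gg x₁ (x₂ - a + b) x₃ with m8 | m8
    swap
    · linarith
    have : e b a x₁ x₂ x₃ = 0 := if_pos (hF b a x₁ x₂ x₃ hs m1 m2 m3 m4 m5 m6 m7 m8)
    linarith
  have hns : ∑ b : G, ∑ a : G, ∑ x₁ : G, ∑ x₂ : G, ∑ x₃ : G, (if ¬ Function.Surjective
      (jointMap β bR ![x₁, x₂, x₃, b, a]) then (1 : ℝ) else 0) ≤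
      η * (Fintype.card G : ℝ) ^ 5 := by
    rw [← mul_le_mul_iff_left₀ hT]
    have h5 := card_not_surjective_quintuple (bR := bR) hβ hT.le
    refine le_trans (le_of_eq ?_) (h5.trans ?_)
    · simp only [Finset.card_filter, Fintype.sum_prod_type, Nat.cast_sum, Nat.cast_ite,
        Nat.cast_one, Nat.cast_zero]
    · have : (Fintype.card M : ℝ) ^ 5 ≤ (Fintype.card M : ℝ) ^ 10 :=
        pow_le_pow_right₀ hK (by norm_num)
      have : (Fintype.card M : ℝ) ^ 5 ≤ η * T := by
        nlinarith [pow_pos (lt_of_lt_of_le one_pos hK) 10]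
      calc _ ≤ η * T * (Fintype.card G : ℝ) ^ 5 := by gcongr
        _ = _ := by ring
  -- 841 = 8·105 + 1: eight quadruples have to be good, and the five columns have to be independent.
  have htot : ∑ b, ∑ a, ∑ x₁, ∑ x₂, ∑ x₃, e b a x₁ x₂ x₃ ≤ 841 * η * (Fintype.card G : ℝ) ^ 5 := by
    refine (Finset.sum_le_sum fun b _ => Finset.sum_le_sum fun a _ => Finset.sum_le_sum fun x₁ _ =>
      Finset.sum_le_sum fun x₂ _ => Finset.sum_le_sum fun x₃ _ => hpt b a x₁ x₂ x₃).trans ?_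
    have hadd : ∀ u v : G → G → G → G → G → ℝ,
        ∑ b, ∑ a, ∑ x₁, ∑ x₂, ∑ x₃, (u b a x₁ x₂ x₃ + v b a x₁ x₂ x₃) =
        ∑ b, ∑ a, ∑ x₁, ∑ x₂, ∑ x₃, u b a x₁ x₂ x₃ +
        ∑ b, ∑ a, ∑ x₁, ∑ x₂, ∑ x₃, v b a x₁ x₂ x₃ := fun u v => by
      simp only [Finset.sum_add_distrib]
    refine (le_of_eq (hadd _ _)).trans ((add_le_add (sum_quintuple g).le hns).trans ?_)
    have := mul_le_mul_of_nonneg_left hbad (show 0 ≤ 8 * (Fintype.card G : ℝ) ^ 2 by positivity)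
    linarith
  -- The adjustment depends on the pair (b, a), so one pair is fixed by averaging.
  obtain ⟨b, hb⟩ := exists_le_of_sum_le_card_mul (c := 841 * η * (Fintype.card G : ℝ) ^ 4)
    (htot.trans (le_of_eq (by ring)))
  obtain ⟨a, ha⟩ := exists_le_of_sum_le_card_mul (c := 841 * η * (Fintype.card G : ℝ) ^ 3)
    (hb.trans (le_of_eq (by ring)))
  obtain ⟨L, R, hLR⟩ := exists_affine_of_relation (F₁ b a) (F₂ b a)
    (fun x => r x - s b a x ∘ₗ colMap β bR x) (F₂ b a) (r b - r a) (-b + a)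
    (ε := 841 * η) (by linarith) (le_of_eq_of_le (by
      simp only [e, sub_eq_add_neg, add_assoc]) ha)
  refine ⟨L.toZModLinearMap p, R, s b a, ?_⟩
  convert hLR using 1
  · congr!
  · ring

end AffineFamily

/-! ### Assembling the bi-affine map -/

section Core

open scoped Classical

variable {p : ℕ} [Fact p.Prime] {G M H : Type*} [AddCommGroup G] [Module (ZMod p) G] [Fintype G]
  [AddCommGroup M] [Module (ZMod p) M] [Fintype M] [AddCommGroup H] [Module (ZMod p) H] [Fintype H]
  {β : G →ₗ[ZMod p] G →ₗ[ZMod p] M} {bR : G →ₗ[ZMod p] M} {a : G → M} {T η : ℝ}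
  {φ : G → G → AddMonoidAlgebra ℝ H}

/-- A map of small total cost is mostly concentrated on the sum of a bi-affine map and a function
of the first variable. -/
theorem exists_biaffine_of_totalCost_le (hφ : ∀ x y, φ x y ∈ simplex H) (hβ : HighRank T β)
    (hT : 0 < T) (hη : 0 < η) (hη' : η ≤ 1 / 27000)
    (hKT : 100 * (Fintype.card M : ℝ) ^ 10 ≤ η * T)
    (hcost : totalCost β bR a φ ≤ η * ∑ d : G × G, ∑ P, ∑ Q,
      weight (bohr β bR a) d.1 d.2 P * weight (bohr β bR a) d.1 d.2 Q) :
    ∃ (L : G →ₗ[ZMod p] G →ₗ[ZMod p] H) (R : G →ₗ[ZMod p] H) (θ : G → H),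
      ∑ x, ∑ y, bohr β bR a x y * (1 - (φ x y).coeff (L x y + R y + θ x)) ≤
        27000 * η * ∑ x, ∑ y, bohr β bR a x y := by
  have hN : (0 : ℝ) < Fintype.card G := by exact_mod_cast Fintype.card_pos
  have hK : (1 : ℝ) ≤ Fintype.card M := by exact_mod_cast Fintype.card_pos
  have hcost' : totalCost β bR a φ ≤
      101 / 100 * η * ((Fintype.card G : ℝ) ^ 8 / (Fintype.card M : ℝ) ^ 7) := by
    have h1 := mul_le_mul_of_nonneg_left (sum_arrangements_le (bR := bR) (a := a) hβ hT
      (hKT.trans (by nlinarith))) hη.le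
    linarith
  obtain ⟨S, r, c, δ, hS, hδ, hd, hδS, hSc⟩ :=
    exists_column_maps hφ hβ hT hη (by linarith) hKT hcost'
  obtain ⟨L, R, s, hLR⟩ := exists_affine_family hβ hT hη hη' hKT
    (sum_badQuad_le hφ hβ hT hη hKT hcost' hS hδ hd hδS hSc)
  have hns := sum_indicator_not_surjective (bR := bR) hβ hT
  -- On the column over x the correction `s x (colMap β bR x y)` is the constant `s x (a x)`, so it
  -- belongs to θ together with the constant term `c x`.
  refine ⟨L, R, fun x => s x (a x) + c x, ?_⟩
  set K : ℝ := (Fintype.card M : ℝ)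
  set N : ℝ := (Fintype.card G : ℝ) with hNdef
  let e₁ : G → ℝ := fun x => if x ∈ S then δ x else 1
  let e₂ : G → ℝ := fun x => if r x - s x ∘ₗ colMap β bR x = L x + R then 0 else 1
  let e₃ : G → ℝ := fun x => if ¬ Function.Surjective (colMap β bR x) then 1 else 0
  have hNK : 0 ≤ N / K := by positivity
  have hpt : ∀ x, ∑ y, bohr β bR a x y * (1 - (φ x y).coeff (L x y + R y + (s x (a x) + c x))) ≤
      (N / K) * (e₁ x + e₂ x) + N * e₃ x := by
    intro x
    have k1 : 0 ≤ e₁ x := by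
      have := hδ x
      simp only [e₁]; split_ifs <;> simp [this]
    have k2 : 0 ≤ e₂ x := by simp only [e₂]; split_ifs <;> simp
    have hle : ∑ y, bohr β bR a x y * (1 - (φ x y).coeff (L x y + R y + (s x (a x) + c x))) ≤
        colCard β bR a x := Finset.sum_le_sum fun y _ =>
      mul_le_of_le_one_right (bohr_nonneg _ _) (sub_le_self _ ((hφ x y).1 _))
    by_cases hs : Function.Surjective (colMap β bR x)
    swap
    · have : e₃ x = 1 := if_pos hs
      rw [this, mul_one]
      exact (hle.trans (colCard_le x)).trans (le_add_of_nonneg_left (by positivity))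
    have : e₃ x = 0 := if_neg (not_not.2 hs)
    rw [this, mul_zero, add_zero]
    rw [colCard_of_surjective hs] at hle
    by_cases hx : x ∈ S
    swap
    · have : e₁ x = 1 := if_neg hx
      rw [this]
      nlinarith
    by_cases hr : r x - s x ∘ₗ colMap β bR x = L x + R
    swap
    · have : e₂ x = 1 := if_neg hr
      rw [this]
      nlinarith
    have f1 : e₁ x = δ x := if_pos hx
    have f2 : e₂ x = 0 := if_pos hr
    rw [f1, f2, add_zero, mul_comm]
    refine le_of_eq_of_le (Finset.sum_congr rfl fun y _ => ?_) (hd x hx)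
    by_cases hy : colMap β bR x y = a x
    · have h2 := LinearMap.congr_fun hr y
      simp only [LinearMap.sub_apply, LinearMap.comp_apply, LinearMap.add_apply, hy] at h2
      rw [← h2, show r x y - s x (a x) + (s x (a x) + c x) = r x y + c x by abel]
    · simp [bohr, hy]
  have hns' : ∑ x, e₃ x ≤ 1 / 100 * η * N / K := by
    refine hns.trans ?_
    rw [div_le_div_iff₀ hT (by linarith)]
    have : K ^ 2 ≤ K ^ 10 := pow_le_pow_right₀ hK (by norm_num)
    nlinarith
  have s1 : ∑ x, e₁ x ≤ 21 * η * N := by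
    rw [← Finset.sum_compl_add_sum S, Finset.sum_congr rfl (g := fun _ => (1 : ℝ))
      (fun x hx => if_neg (Finset.mem_compl.1 hx)),
      Finset.sum_congr rfl (g := δ) (fun x hx => if_pos hx)]
    simp only [Finset.sum_const, nsmul_eq_mul, mul_one]
    linarith
  -- At least half of the columns have the expected N/K points, so |B| ≥ N²/(2K), and a defect of
  -- 3385.01 ηN²/K stays well within 27000 η|B|.
  have hB : (N / K) * (N - ∑ x, e₃ x) ≤ ∑ x, ∑ y, bohr β bR a x y := by
    have : N = ∑ _x : G, (1 : ℝ) := by simp [hNdef]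
    rw [this, ← Finset.sum_sub_distrib, ← this, Finset.mul_sum]
    refine Finset.sum_le_sum fun x _ => ?_
    by_cases hs : Function.Surjective (colMap β bR x)
    · have : e₃ x = 0 := if_neg (not_not.2 hs)
      rw [this, sub_zero, mul_one]
      exact (colCard_of_surjective hs).ge
    · have : e₃ x = 1 := if_pos hs
      rw [this, sub_self, mul_zero]
      exact colCard_nonneg x
  have hns'' : ∑ x, e₃ x ≤ 1 / 2 * N := by
    refine hns'.trans ?_
    rw [div_le_iff₀ (by linarith)]
    have : η * N ≤ N * K := by nlinarith
    linarith
  calc _ ≤ ∑ x, ((N / K) * (e₁ x + e₂ x) + N * e₃ x) := Finset.sum_le_sum fun x _ => hpt x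
    _ = (N / K) * (∑ x, e₁ x + ∑ x, e₂ x) + N * ∑ x, e₃ x := by
        rw [Finset.sum_add_distrib, ← Finset.mul_sum, ← Finset.mul_sum, Finset.sum_add_distrib]
    _ ≤ (N / K) * (21 * η * N + 3364 * η * N) + N * (1 / 100 * η * N / K) := by gcongr
    _ = 3385.01 * η * ((N / K) * N) := by ring
    _ ≤ 27000 * η * ((N / K) * (N - 1 / 2 * N)) := by
        have : 0 ≤ η * ((N / K) * N) := by positivity
        linarith
    _ ≤ 27000 * η * ((N / K) * (N - ∑ x, e₃ x)) := by gcongr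
    _ ≤ _ := by gcongr

end Core

/-! ### Rank and codimension of Bohr sets -/

section RankReduction

open scoped Classical

variable {p : ℕ} [Fact p.Prime] {G : Type*} [AddCommGroup G] [Module (ZMod p) G] [Fintype G]

/-- The flip is the dual map of f composed with the evaluation isomorphism onto the bidual, and a
linear map and its dual have equal rank. -/
lemma formRank_flip (f : G →ₗ[ZMod p] G →ₗ[ZMod p] ZMod p) : formRank f.flip = formRank f := by
  have h : f.flip = (LinearMap.dualMap f) ∘ₗ (Module.evalEquiv (ZMod p) G).toLinearMap := by
    ext x y
    simp
  rw [formRank, formRank, h, LinearMap.range_comp_of_range_eq_top _ (LinearEquiv.range _)]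
  exact LinearMap.finrank_range_dualMap_eq_finrank_range f

lemma card_ker_mul_le {t : ℕ} (f : G →ₗ[ZMod p] G →ₗ[ZMod p] ZMod p) (ht : t ≤ formRank f) :
    ((Finset.univ.filter fun x => f x = 0).card : ℝ) * (p : ℝ) ^ t ≤ Fintype.card G := by
  have h1 : (Finset.univ.filter fun x => f x = 0).card = Fintype.card (LinearMap.ker f) := by
    rw [Fintype.card_subtype]
    congr!
  have h2 := LinearMap.finrank_range_add_finrank_ker f
  have h3 : Fintype.card G = p ^ Module.finrank (ZMod p) (LinearMap.range f) *
      Fintype.card (LinearMap.ker f) := by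
    rw [Module.card_eq_pow_finrank (K := ZMod p) (V := G),
      Module.card_eq_pow_finrank (K := ZMod p) (V := LinearMap.ker f), ZMod.card, ← pow_add, h2]
  have hp : 1 ≤ p := (Fact.out : p.Prime).one_le
  rw [h1, h3]
  push_cast
  rw [mul_comm]
  gcongr
  · exact_mod_cast hp
  · exact ht

lemma highRank_of_le_rank {k t : ℕ} (γ : Biaffine (ZMod p) G G (Fin k → ZMod p))
    (h : (t : ℕ∞) ≤ γ.rank) : HighRank ((p : ℝ) ^ t) γ.bilin := by
  intro ξ hξ
  let u : Fin k → ZMod p := fun i => ξ (Pi.single i 1)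
  have hu : ξ = ∑ i, u i • (LinearMap.proj i : (Fin k → ZMod p) →ₗ[ZMod p] ZMod p) := by
    refine LinearMap.pi_ext fun i x => ?_
    have : (Pi.single i x : Fin k → ZMod p) = x • Pi.single i 1 := by
      rw [← Pi.single_smul, smul_eq_mul, mul_one]
    rw [this, map_smul, map_smul]
    congr 1
    simp [u, LinearMap.sum_apply, Pi.single_apply]
  have hu0 : u ≠ 0 := by
    rintro h0
    apply hξ
    rw [hu, h0]
    simp
  have hr : t ≤ formRank (γ.bilin.compr₂ ξ) := by
    have h1 := h.trans (iInf_le _ ⟨u, hu0⟩)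
    rw [← hu] at h1
    exact_mod_cast h1
  refine ⟨?_, ?_⟩
  · convert card_ker_mul_le _ hr using 4
    congr!
  · rw [← formRank_flip] at hr
    convert card_ker_mul_le _ hr using 4
    congr!

lemma card_le_fiber_mul {M : Type*} [AddCommGroup M] [Module (ZMod p) M] [Fintype M]
    (L : G →ₗ[ZMod p] M) (y₀ : G) [DecidablePred fun y => L y = L y₀] : Fintype.card G ≤
      (Finset.univ.filter fun y => L y = L y₀).card * Fintype.card M := by
  have h := Finset.card_eq_sum_card_fiberwise (s := Finset.univ) (t := Finset.univ) (f := L)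
    (fun _ _ => Finset.mem_coe.2 (Finset.mem_univ _))
  rw [Finset.card_univ] at h
  rw [h, mul_comm]
  refine (Finset.sum_le_card_nsmul _ _ _ fun m _ => ?_).trans (le_of_eq (by simp; rfl))
  exact (card_fiber_le_card_ker L m).trans
    (le_of_eq (by convert AddMonoidHom.card_fiber_eq_of_mem_range L ⟨0, map_zero L⟩ ⟨y₀, rfl⟩))

lemma absurd_of_mul_le {N c K A q : ℝ} (hN : 0 < N) (hK : 0 ≤ K) (hq : 0 ≤ q) (h₁ : N ≤ c * K)
    (h₂ : c * q ≤ A * N) (h₃ : A * K < q) : False := by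
  have h : N * q ≤ N * (A * K) := by
    calc N * q ≤ c * K * q := by gcongr
      _ = c * q * K := by ring
      _ ≤ A * N * K := by gcongr
      _ = _ := by ring
  exact absurd (le_of_mul_le_mul_left h hN) (not_le.2 h₃)

/-- A level set of a bi-affine map of high rank to a space of dimension `l` is not a level set of
a bi-affine map to a space of smaller dimension. -/
lemma codim_le_of_isLevelSet {B : Finset (G × G)} (hB : B.Nonempty) {k l t : ℕ}
    {γ : Biaffine (ZMod p) G G (Fin k → ZMod p)} {z : Fin k → ZMod p} (hγ : IsLevelSet B γ z)
    {γ' : Biaffine (ZMod p) G G (Fin l → ZMod p)} {z' : Fin l → ZMod p} (hγ' : IsLevelSet B γ' z')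
    (hrank : (t : ℕ∞) ≤ γ'.rank) (ht : 1 ≤ t) (hkt : 60 * k ≤ t) : l ≤ k := by
  by_contra! hlt
  have hHR := highRank_of_le_rank γ' hrank
  have hp : 1 < p := (Fact.out : p.Prime).one_lt
  have hp' : (1 : ℝ) < p := by exact_mod_cast hp
  have hN : (0 : ℝ) < Fintype.card G := by exact_mod_cast Fintype.card_pos
  obtain ⟨⟨x₀, y₀⟩, hq⟩ := hB
  -- If l > k, already the first k + 1 coordinates of γ' are to give a contradiction. Non-zero
  -- functionals pull back to non-zero ones under π, so the truncated map keeps the high rank.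
  let π : (Fin l → ZMod p) →ₗ[ZMod p] (Fin (k + 1) → ZMod p) :=
    LinearMap.funLeft (ZMod p) (ZMod p) (Fin.castLE hlt)
  have hπ : Function.Surjective π :=
    LinearMap.funLeft_surjective_of_injective _ _ _ (Fin.castLE_injective hlt)
  let β := γ'.bilin.compr₂ π
  let bR := π ∘ₗ γ'.right
  have hβ : HighRank ((p : ℝ) ^ t) β := by
    intro ξ hξ
    refine hHR (ξ ∘ₗ π) fun h0 => hξ (LinearMap.ext fun v => ?_)
    obtain ⟨w, rfl⟩ := hπ v
    exact LinearMap.congr_fun h0 w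
  obtain ⟨x, y, hxy, hs⟩ : ∃ x y, (x, y) ∈ B ∧ Function.Surjective (colMap β bR x) := by
    by_contra! hcon
    -- For k = 0 the comparison p^(2k+1) < p^t used below may fail, as t may be 1. Then `B` is all
    -- of G², so the bilinear part of γ' vanishes, against t ≥ 1. For k > 0 the row of `B` through
    -- (x₀, y₀) has at least N/p^k points, more than there are columns whose map is not onto.
    rcases Nat.eq_zero_or_pos k with rfl | hk
    · have hall : ∀ x y, γ'.eval x y = z' := fun x y =>
        (hγ' x y).1 ((hγ x y).2 (Subsingleton.elim _ _))
      have hzero : γ'.bilin = 0 := by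
        refine LinearMap.ext fun x => LinearMap.ext fun y => ?_
        have h1 := hall x y
        have h2 := hall x 0
        have h3 := hall 0 y
        have h4 := hall 0 0
        simp only [Biaffine.eval, map_zero, LinearMap.zero_apply, zero_add, add_zero]
          at h1 h2 h3 h4
        rw [LinearMap.zero_apply, LinearMap.zero_apply]
        have : γ'.bilin x y = (γ'.bilin x y + γ'.left x + γ'.right y + γ'.const) -
          (γ'.left x + γ'.const) - (γ'.right y + γ'.const) + γ'.const := by abel
        rw [this, h1, h2, h3, h4]
        abel
      have h1 := (hHR (LinearMap.proj ⟨0, hlt⟩) (fun h0 => by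
        have := LinearMap.congr_fun h0 (fun _ => 1)
        simp at this)).1
      simp only [hzero, LinearMap.zero_apply, LinearMap.comp_zero, Finset.filter_true,
        Finset.card_univ] at h1
      have h2 : (1 : ℝ) < (p : ℝ) ^ t := one_lt_pow₀ hp' (by omega)
      nlinarith
    · have h1 := card_not_surjective_col (bR := bR) hβ (by positivity)
      let L := γ.bilin.flip y₀ + γ.left
      have h2 := card_le_fiber_mul L x₀
      have h3 : (Finset.univ.filter fun x => L x = L x₀) ⊆
          Finset.univ.filter fun x => ¬ Function.Surjective (colMap β bR x) := by
        intro x hx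
        have hx := (Finset.mem_filter.1 hx).2
        refine Finset.mem_filter.2 ⟨Finset.mem_univ _, hcon x y₀ ((hγ x y₀).2 ?_)⟩
        rw [← (hγ x₀ y₀).1 hq]
        simp only [L, LinearMap.add_apply, LinearMap.flip_apply] at hx
        simp only [Biaffine.eval, add_assoc]
        rw [← add_assoc, hx, add_assoc]
      have h4 := h2.trans (Nat.mul_le_mul_right _ (Finset.card_le_card h3))
      have h5 : (Fintype.card G : ℝ) ≤ ((Finset.univ.filter fun x =>
          ¬ Function.Surjective (colMap β bR x)).card : ℝ) * (p : ℝ) ^ k := by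
        simp only [Fintype.card_pi, ZMod.card, Finset.prod_const, Finset.card_univ,
          Fintype.card_fin] at h4
        exact_mod_cast h4
      simp only [Fintype.card_pi, ZMod.card, Finset.prod_const, Finset.card_univ,
        Fintype.card_fin] at h1
      push_cast at h1
      have h6 : (p : ℝ) ^ (k + 1) * (p : ℝ) ^ k < (p : ℝ) ^ t := by
        rw [← pow_add]
        exact pow_lt_pow_right₀ hp' (by omega)
      refine absurd_of_mul_le hN (by positivity) (by positivity) h5 ?_ h6
      convert h1 using 4
      congr!
  -- On this column `B` contains a coset of the kernel of L, of size at least N/p^k. It lies in a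
  -- fibre of the truncated column map of γ', of size N/p^(k+1).
  let L := γ.bilin x + γ.right
  have h1 := card_le_fiber_mul L y
  have h2 : (Finset.univ.filter fun y' => colMap β bR x y' = colMap β bR x y).card *
      Fintype.card (Fin (k + 1) → ZMod p) = Fintype.card G := by
    convert card_fiber_mul_card (colMap β bR x) hs (colMap β bR x y) using 3
    congr!
  have h3 : (Finset.univ.filter fun y' => L y' = L y) ⊆
      Finset.univ.filter fun y' => colMap β bR x y' = colMap β bR x y := by
    intro y' hy'
    have hy' := (Finset.mem_filter.1 hy').2
    refine Finset.mem_filter.2 ⟨Finset.mem_univ _, ?_⟩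
    have hmem : (x, y') ∈ B := by
      rw [hγ, ← (hγ x y).1 hxy]
      simp only [L, LinearMap.add_apply] at hy'
      have : ∀ v, γ.eval x v = (γ.bilin x v + γ.right v) + γ.left x + γ.const := fun v => by
        simp only [Biaffine.eval]
        abel
      rw [this, this, hy']
    have e1 := (hγ' x y').1 hmem
    rw [← (hγ' x y).1 hxy] at e1
    have : ∀ v, colMap β bR x v = π (γ'.eval x v) - π (γ'.left x) - π γ'.const := fun v => by
      simp only [Biaffine.eval, map_add, colMap, β, bR, LinearMap.add_apply,
        LinearMap.compr₂_apply, LinearMap.comp_apply]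
      abel
    rw [this, this, e1]
  have h4 := h1.trans (Nat.mul_le_mul_right _ (Finset.card_le_card h3))
  simp only [Fintype.card_pi, ZMod.card, Finset.prod_const, Finset.card_univ,
    Fintype.card_fin] at h2 h4
  have h5 : 0 < Fintype.card G := Fintype.card_pos
  rw [← h2, pow_succ, ← mul_assoc] at h4 h5
  have h6 : 0 < (Finset.univ.filter fun y' => colMap β bR x y' = colMap β bR x y).card * p ^ k :=
    Nat.pos_of_ne_zero fun h0 => by rw [h0, zero_mul] at h5; exact h5.false
  nlinarith

/-- As t is finite and positive, being at least t means exceeding t - 1, so some member of the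
supremum does so; its rank may be infinite. -/
lemma exists_of_le_bohrRank {B : Finset (G × G)} (hB : B.Nonempty) {t : ℕ} (ht : 1 ≤ t)
    (h : (t : ℕ∞) ≤ bohrRank (ZMod p) B) :
    ∃ (l : ℕ) (γ : Biaffine (ZMod p) G G (Fin l → ZMod p)) (z : Fin l → ZMod p),
      IsLevelSet B γ z ∧ (t : ℕ∞) ≤ γ.rank := by
  rw [bohrRank, if_neg hB.ne_empty] at h
  obtain ⟨s, rfl⟩ : ∃ s, t = s + 1 := ⟨t - 1, by omega⟩
  have hlt : (s : ℕ∞) < (s + 1 : ℕ) := by exact_mod_cast Nat.lt_succ_self s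
  obtain ⟨_, ⟨l, γ, z, hγ, rfl⟩, hr⟩ := lt_sSup_iff.1 (hlt.trans_le h)
  refine ⟨l, γ, z, hγ, ?_⟩
  push_cast
  exact Order.add_one_le_of_lt hr

end RankReduction

/-- Exponentiating the hypothesis gives p^t ≥ p^(60k) η⁻⁹. One factor η⁻¹ cancels η, the other eight
absorb the constant 100, and 60k exceeds 10l. -/
lemma mul_pow_le_of_logb_le {p : ℕ} (hp : 1 < p) {k l t : ℕ} {η : ℝ} (hη : 0 < η)
    (hη' : η ≤ 1 / 27000) (ht : 60 * (k : ℝ) + 9 * Real.logb p η⁻¹ ≤ t) (hl : l ≤ k) :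
    100 * ((p : ℝ) ^ l) ^ 10 ≤ η * (p : ℝ) ^ t := by
  have hp' : (1 : ℝ) < p := by exact_mod_cast hp
  have hp0 : (0 : ℝ) < p := by linarith
  have h1 : (p : ℝ) ^ (60 * k) * η⁻¹ ^ 9 ≤ (p : ℝ) ^ t := by
    have h := Real.rpow_le_rpow_of_exponent_le hp'.le ht
    rw [Real.rpow_add hp0, Real.rpow_natCast, mul_comm (9 : ℝ), Real.rpow_mul hp0.le (Real.logb _ _),
      Real.rpow_logb hp0 hp'.ne' (inv_pos.2 hη)] at h
    exact_mod_cast h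
  have h2 : 100 ≤ η⁻¹ ^ 8 := by
    have : 27000 ≤ η⁻¹ := by
      rw [le_inv_comm₀ (by norm_num) hη]
      simpa using hη'
    calc (100 : ℝ) ≤ 27000 ^ 8 := by norm_num
      _ ≤ _ := by gcongr
  calc 100 * ((p : ℝ) ^ l) ^ 10 ≤ η⁻¹ ^ 8 * (p : ℝ) ^ (60 * k) := by
        rw [← pow_mul]
        exact mul_le_mul h2 (pow_le_pow_right₀ hp'.le (by omega)) (by positivity) (by positivity)
    _ = η * ((p : ℝ) ^ (60 * k) * η⁻¹ ^ 9) := by field_simp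
    _ ≤ _ := by gcongr

lemma one_le_of_logb_le {p : ℕ} (hp : 1 < p) {k t : ℕ} {η : ℝ} (hη : 0 < η)
    (hη' : η ≤ 1 / 27000) (ht : 60 * (k : ℝ) + 9 * Real.logb p η⁻¹ ≤ t) :
    1 ≤ t ∧ 60 * k ≤ t := by
  have h : 0 < Real.logb p η⁻¹ :=
    Real.logb_pos (by exact_mod_cast hp) ((one_lt_inv₀ hη).2 (by linarith))
  constructor
  · have hk : (0 : ℝ) ≤ k := by positivity
    have : (0 : ℝ) < t := by linarith
    exact_mod_cast this
  · have : 60 * (k : ℝ) ≤ t := by linarith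
    exact_mod_cast this

lemma ip_expect_smul {ι H : Type*} [Fintype ι] [AddCommGroup H] [Fintype H] (u : ι → ℝ)
    (F : ι → AddMonoidAlgebra ℝ H) :
    ip (𝔼 P, u P • F P) (𝔼 P, u P • F P) =
      (∑ P, ∑ Q, u P * u Q * ip (F P) (F Q)) / (Fintype.card ι : ℝ) ^ 2 := by
  have h : ∀ a, (𝔼 P, u P • F P).coeff a = (∑ P, u P * (F P).coeff a) / Fintype.card ι := by
    intro a
    rw [← Fintype.expect_eq_sum_div_card]
    simp [Finset.expect, AddMonoidAlgebra.coeff_sum]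
  simp only [ip, h, div_mul_div_comm]
  rw [← Finset.sum_div, ← pow_two]
  congr 1
  simp only [Finset.sum_mul_sum]
  rw [Finset.sum_comm]
  refine Finset.sum_congr rfl fun P _ => ?_
  rw [Finset.sum_comm]
  simp only [Finset.mul_sum]
  exact Finset.sum_congr rfl fun Q _ => Finset.sum_congr rfl fun a _ => by ring

lemma ncard_eq_sum {α β γ : Type*} [Fintype α] [Fintype β] [Fintype γ] (S : Set (α × β × γ))
    [DecidablePred (· ∈ S)] :
    (S.ncard : ℝ) = ∑ a, ∑ b, ∑ c, if (a, b, c) ∈ S then 1 else 0 := by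
  rw [Set.ncard_eq_toFinset_card', ← Set.filter_mem_univ_eq_toFinset, Finset.card_filter]
  push_cast
  simp only [Fintype.sum_prod_type]

/-! ### From the definitions to the total cost -/

section Main

open scoped Classical

variable {p : ℕ} [Fact p.Prime] {G M H : Type*} [AddCommGroup G] [Module (ZMod p) G] [Fintype G]
  [AddCommGroup M] [Module (ZMod p) M] [Fintype M] [AddCommGroup H] [Module (ZMod p) H] [Fintype H]
  {β : G →ₗ[ZMod p] G →ₗ[ZMod p] M} {bR : G →ₗ[ZMod p] M} {a : G → M} {η : ℝ}

lemma sum_weight_mul_cost_eq (μ : G → G → ℝ) (φ : G → G → AddMonoidAlgebra ℝ H) :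
    ∑ d : G × G, ∑ P, ∑ Q, weight μ d.1 d.2 P * weight μ d.1 d.2 Q * cost φ d.1 d.2 P Q =
      ∑ d : G × G, ∑ P, ∑ Q, weight μ d.1 d.2 P * weight μ d.1 d.2 Q -
      ∑ d : G × G, ∑ P, ∑ Q, weight μ d.1 d.2 P * weight μ d.1 d.2 Q *
        ip (algValue φ d.1 d.2 P) (algValue φ d.1 d.2 Q) := by
  simp only [cost, mul_sub, mul_one, Finset.sum_sub_distrib]

/-- Expanding the squared norms over pairs (P, Q) turns the definition into an upper bound for the
total cost; both sides carry the same normalisation. -/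
lemma IsNearBihom.sum_weight_mul_cost_le {μ : G → G → ℝ} {φ : G → G → AddMonoidAlgebra ℝ H}
    (h : IsNearBihom η μ φ) :
    ∑ d : G × G, ∑ P, ∑ Q, weight μ d.1 d.2 P * weight μ d.1 d.2 Q * cost φ d.1 d.2 P Q ≤
      η * ∑ d : G × G, ∑ P, ∑ Q, weight μ d.1 d.2 P * weight μ d.1 d.2 Q := by
  rw [IsNearBihom] at h
  simp only [ip_expect_smul] at h
  simp only [Fintype.expect_eq_sum_div_card, sq_abs, div_pow, ← Finset.sum_div,
    pow_two (Finset.sum _ _), Finset.sum_mul_sum] at h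
  rw [← mul_div_assoc, ← mul_div_assoc, div_le_div_iff_of_pos_right (by positivity),
    div_le_div_iff_of_pos_right (by positivity)] at h
  rw [sum_weight_mul_cost_eq]
  linarith

lemma charFun_eq_bohr [DecidableEq G] {l : ℕ} {B : Finset (G × G)}
    {γ : Biaffine (ZMod p) G G (Fin l → ZMod p)} {z : Fin l → ZMod p} (hγ : IsLevelSet B γ z) :
    charFun B = bohr γ.bilin γ.right fun x => z - γ.left x - γ.const := by
  funext x y
  have h : (x, y) ∈ B ↔ colMap γ.bilin γ.right x y = z - γ.left x - γ.const := by
    rw [hγ, Biaffine.eval, colMap, LinearMap.add_apply, sub_sub, eq_sub_iff_add_eq]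
    exact Eq.congr_left (by abel)
  simp only [charFun, bohr, h]
  congr

lemma sum_mem_eq_sum_charFun_mul [DecidableEq G] (B : Finset (G × G)) (f : G → G → ℝ) :
    ∑ q ∈ B, f q.1 q.2 = ∑ x, ∑ y, charFun B x y * f x y := by
  rw [← Fintype.sum_prod_type' fun x y => charFun B x y * f x y]
  simp [charFun]

lemma weight_charFun [DecidableEq G] (B : Finset (G × G)) (w h : G) (P : G × G × G) :
    weight (charFun B) w h P = if InSet B w h P then 1 else 0 := by
  obtain ⟨x, y, y'⟩ := P
  simp only [weight, charFun, InSet, ite_mul, one_mul, zero_mul]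
  split_ifs <;> simp_all

lemma ncard_arrangements [DecidableEq G] (B : Finset (G × G)) :
    ((arrangements B).ncard : ℝ) = ∑ d : G × G, ∑ P, ∑ Q,
      weight (charFun B) d.1 d.2 P * weight (charFun B) d.1 d.2 Q := by
  rw [ncard_eq_sum]
  refine Finset.sum_congr rfl fun d _ => Finset.sum_congr rfl fun P _ =>
    Finset.sum_congr rfl fun Q _ => ?_
  have h : (d, P, Q) ∈ arrangements B ↔ InSet B d.1 d.2 P ∧ InSet B d.1 d.2 Q := Iff.rfl
  rw [weight_charFun, weight_charFun]
  by_cases h₁ : InSet B d.1 d.2 P <;> simp [h, h₁]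

lemma ncard_respectedArrangements [DecidableEq G] (B : Finset (G × G)) (φ : G → G → H) :
    ((respectedArrangements B φ).ncard : ℝ) = ∑ d : G × G, ∑ P, ∑ Q,
      weight (charFun B) d.1 d.2 P * weight (charFun B) d.1 d.2 Q *
        ip (algValue (fun x y => delta (φ x y)) d.1 d.2 P)
          (algValue (fun x y => delta (φ x y)) d.1 d.2 Q) := by
  rw [ncard_eq_sum]
  refine Finset.sum_congr rfl fun d _ => Finset.sum_congr rfl fun P _ =>
    Finset.sum_congr rfl fun Q _ => ?_
  have h : (d, P, Q) ∈ respectedArrangements B φ ↔ (InSet B d.1 d.2 P ∧ InSet B d.1 d.2 Q) ∧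
    groupValue φ d.1 d.2 P = groupValue φ d.1 d.2 Q := Iff.rfl
  rw [weight_charFun, weight_charFun, algValue_delta, algValue_delta, ip_delta_delta]
  by_cases h₁ : InSet B d.1 d.2 P <;> by_cases h₂ : InSet B d.1 d.2 Q <;> simp [h, h₁, h₂]

/-- A map of small cost over the 4-arrangements in a bilinear Bohr set of high rank is mostly
concentrated, on this set, on the sum of a bi-affine map and a function of the first variable. -/
theorem exists_biaffine_of_isLevelSet [DecidableEq G] {B : Finset (G × G)} {k t : ℕ}
    (hB : IsBohrSet (ZMod p) k B) (hrank : (t : ℕ∞) ≤ bohrRank (ZMod p) B) (hη : 0 < η)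
    (ht : 60 * (k : ℝ) + 9 * Real.logb p η⁻¹ ≤ t) {φ : G → G → AddMonoidAlgebra ℝ H}
    (hφ : ∀ x y, φ x y ∈ simplex H)
    (hcost : ∑ d : G × G, ∑ P, ∑ Q, weight (charFun B) d.1 d.2 P * weight (charFun B) d.1 d.2 Q *
        cost φ d.1 d.2 P Q ≤
      η * ∑ d : G × G, ∑ P, ∑ Q, weight (charFun B) d.1 d.2 P * weight (charFun B) d.1 d.2 Q) :
    ∃ (γ : Biaffine (ZMod p) G G H) (θ : G → H),
      ∑ q ∈ B, (1 - (φ q.1 q.2).coeff (γ.eval q.1 q.2 + θ q.1)) ≤ 27000 * η * B.card := by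
  have hp : 1 < p := (Fact.out : p.Prime).one_lt
  -- For larger η the claimed bound exceeds |B| and every choice works.
  rcases lt_or_ge (1 / 27000) η with hη' | hη'
  · refine ⟨⟨0, 0, 0, 0⟩, 0, (Finset.sum_le_card_nsmul _ _ 1 fun q _ => ?_).trans ?_⟩
    · linarith [(hφ q.1 q.2).1 ((⟨0, 0, 0, 0⟩ : Biaffine (ZMod p) G G H).eval q.1 q.2 +
        (0 : G → H) q.1)]
    · rw [nsmul_one]
      exact le_mul_of_one_le_left (by positivity) (by linarith)
  rcases B.eq_empty_or_nonempty with rfl | hne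
  · exact ⟨⟨0, 0, 0, 0⟩, 0, by simp⟩
  obtain ⟨ht1, hkt⟩ := one_le_of_logb_le hp hη hη' ht
  obtain ⟨l, γ, z, hγ, hr⟩ := exists_of_le_bohrRank hne ht1 hrank
  obtain ⟨γ₀, z₀, hγ₀⟩ := hB
  have hl := codim_le_of_isLevelSet hne hγ₀ hγ hr ht1 hkt
  rw [charFun_eq_bohr hγ] at hcost
  obtain ⟨L, R, θ, h⟩ := exists_biaffine_of_totalCost_le hφ (highRank_of_le_rank γ hr)
    (by positivity) hη hη' (by
      simpa [ZMod.card] using mul_pow_le_of_logb_le hp hη hη' ht hl) hcost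
  refine ⟨⟨L, 0, R, 0⟩, θ, ?_⟩
  rw [← charFun_eq_bohr hγ] at h
  have e : (B.card : ℝ) = ∑ x, ∑ y, charFun B x y := by
    simpa using sum_mem_eq_sum_charFun_mul B fun _ _ => 1
  rw [sum_mem_eq_sum_charFun_mul B fun x y =>
    1 - (φ x y).coeff ((⟨L, 0, R, 0⟩ : Biaffine (ZMod p) G G H).eval x y + θ x), e]
  simpa [Biaffine.eval] using h

end Main

end NearBihom

end

theorem mainTheorem4 (p : ℕ) [Fact p.Prime] (n m k t : ℕ) (η : ℝ) (hη : 0 < η)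
    (B : Finset ((Fin n → ZMod p) × (Fin n → ZMod p)))
    (hB : NearBihom.IsBohrSet (ZMod p) k B)
    (hrank : (t : ℕ∞) ≤ NearBihom.bohrRank (ZMod p) B)
    (ht : 60 * (k : ℝ) + 9 * Real.logb p η⁻¹ ≤ t) :
    (∀ φ : (Fin n → ZMod p) → (Fin n → ZMod p) → AddMonoidAlgebra ℝ (Fin m → ZMod p),
      (∀ x y, φ x y ∈ NearBihom.simplex (Fin m → ZMod p)) →
      NearBihom.IsNearBihom η (NearBihom.charFun B) φ →
      ∃ (γ : NearBihom.Biaffine (ZMod p) (Fin n → ZMod p) (Fin n → ZMod p) (Fin m → ZMod p))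
        (θ : (Fin n → ZMod p) → (Fin m → ZMod p)),
        𝔼 q ∈ B, NearBihom.dist (φ q.1 q.2) (NearBihom.delta (γ.eval q.1 q.2 + θ q.1))
          ≤ 27000 * η) ∧
    (∀ φ : (Fin n → ZMod p) → (Fin n → ZMod p) → (Fin m → ZMod p),
      (1 - η) * ((NearBihom.arrangements B).ncard : ℝ) ≤
        ((NearBihom.respectedArrangements B φ).ncard : ℝ) →
      ∃ (γ : NearBihom.Biaffine (ZMod p) (Fin n → ZMod p) (Fin n → ZMod p) (Fin m → ZMod p))
        (θ : (Fin n → ZMod p) → (Fin m → ZMod p)),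
        (1 - 27000 * η) * (B.card : ℝ) ≤
          ((B.filter fun q => φ q.1 q.2 = γ.eval q.1 q.2 + θ q.1).card : ℝ)) := by
  refine ⟨fun φ hφ h => ?_, fun φ h => ?_⟩
  · obtain ⟨γ, θ, hγ⟩ := NearBihom.exists_biaffine_of_isLevelSet hB hrank hη ht hφ
      h.sum_weight_mul_cost_le
    refine ⟨γ, θ, ?_⟩
    simp only [NearBihom.dist_delta (hφ _ _)]
    rw [Finset.expect_eq_sum_div_card]
    -- This form of the division also covers empty `B`, where the average is a division by 0 and
    -- equals 0.
    exact div_le_of_le_mul₀ (by positivity) (by positivity) hγ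
  · rw [NearBihom.ncard_arrangements, NearBihom.ncard_respectedArrangements] at h
    -- For point masses the cost is the indicator of an arrangement that is not respected, and the
    -- defect at (x, y) is the indicator of φ(x, y) ≠ γ(x, y) + θ(x).
    obtain ⟨γ, θ, hγ⟩ := NearBihom.exists_biaffine_of_isLevelSet hB hrank hη ht
      (fun x y => NearBihom.delta_mem_simplex (φ x y))
      (by rw [NearBihom.sum_weight_mul_cost_eq]; linarith)
    refine ⟨γ, θ, ?_⟩
    simp only [NearBihom.delta, AddMonoidAlgebra.coeff_single, Finsupp.single_apply,
      Finset.sum_sub_distrib, Finset.sum_const, nsmul_one, Finset.sum_boole] at hγ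
    linarith
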